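/- All Hilbert spaces are complex, $\otimes$ between Hilbert spaces is the completed (Hilbert) tensor product, and inner products are conjugate-linear in the first variable. For a self-adjoint operator $T\ge c>0$ (in the sense of quadratic forms), $T^{-s}$ ($s>0$) denotes the bounded operator given by the functional calculus. On $L^2(\mathbb R^m)$, $-\Delta$ is the self-adjoint Laplacian with domain $H^2(\mathbb R^m)$ (written $-\partial_z^2$ if $m=1$), and $A\otimes I+I\otimes B$ is the closure of the operator defined on the algebraic tensor product of the domains. For a mollifier $\eta\in C_c^\infty(\mathbb R^m)$, i.e. $\int\eta=1$, put $\eta_\varepsilon(y)=\varepsilon^{-m}\eta(y/\varepsilon)$. Operator integrals are operator-norm Bochner integrals. **Proposition (Auxiliary integer-order lift).** (1) Let $A\ge\ell I$, $\ell>0$, be a self-adjoint operator on a Hilbert space $H$, and let $\widetilde A=A\otimes I+I\otimes(-\partial_z^2)$ on $H\otimes L^2(\mathbb R)$. Then $\widetilde A$ is self-adjoint with $\widetilde A\ge\ell I$, and for every mollifier $\rho\in C_c^\infty(\mathbb R)$ and all $F,G\in H$, $$\lim_{\delta\to0^+}\big\langle F\otimes\rho_\delta,\ \widetilde A^{-3}(G\otimes\rho_\delta)\big\rangle_{H\otimes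 L^2(\mathbb R)}=\frac3{16}\,\big\langle F,A^{-5/2}G\big\rangle_H .$$ Moreover, with a convergent integral, $$\int_{\mathbb R}\frac{dp}{2\pi}\,(A+p^2)^{-3}=\frac3{16}A^{-5/2}.$$ (2) Let $L_B\ge\ell_B I$, $\ell_B>0$, be a self-adjoint operator on a Hilbert space $H_B$, let $L_M=L_B\otimes I+I\otimes(-\Delta)$ on $H_B\otimes L^2(\mathbb R^3)$ and $\widetilde L=L_M\otimes I+I\otimes(-\partial_z^2)$ on $(H_B\otimes L^2(\mathbb R^3))\otimes L^2(\mathbb R)$. Then $L_M$ and $\widetilde L$ are self-adjoint and bounded below by $\ell_B$, and the following hold. (a) For all mollifiers $\rho\in C_c^\infty(\mathbb R)$, $\eta\in C_c^\infty(\mathbb R^3)$ and all $J,K\in H_B$: for every $\varepsilon>0$, $$\lim_{\delta\to0^+}\big\langle J\otimes\eta_\varepsilon\otimes\rho_\delta,\ \widetilde L^{-3}(K\otimes\eta_\varepsilon\otimes\rho_\delta)\big\rangle=\frac3{16}\big\langle J\otimes\eta_\varepsilon,\ L_M^{-5/2}(K\otimes\eta_\varepsilon)\big\rangle,$$ and $$\lim_{\varepsilon\to0^+}\big\langle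 J\otimes\eta_\varepsilon,\ L_M^{-5/2}(K\otimes\eta_\varepsilon)\big\rangle=\frac1{6\pi^2}\langle J,L_B^{-1}K\rangle ,$$ so that, letting $\delta\to0^+$ and then $\varepsilon\to0^+$, $$\lim_{\varepsilon\to0^+}\ \lim_{\delta\to0^+}\big\langle J\otimes\eta_\varepsilon\otimes\rho_\delta,\ \widetilde L^{-3}(K\otimes\eta_\varepsilon\otimes\rho_\delta)\big\rangle=\frac1{32\pi^2}\langle J,L_B^{-1}K\rangle .$$ (b) With convergent integrals, $$\frac{16}{3}\int_{\mathbb R}\frac{dp}{2\pi}(L_M+p^2)^{-3}=L_M^{-5/2},\qquad \int_{\mathbb R^3}\frac{d^3q}{(2\pi)^3}(L_B+|q|^2)^{-5/2}=\frac1{6\pi^2}L_B^{-1}.$$ (c) The map $(q,p)\mapsto(L_B+|q|^2+p^2)^{-3}$ is Bochner integrable on $\mathbb R^3\times\mathbb R$ and $$\int_{\mathbb R^3}\frac{d^3q}{(2\pi)^3}\int_{\mathbb R}\frac{dp}{2\pi}\,(L_B+|q|^2+p^2)^{-3}=\frac1{32\pi^2}L_B^{-1}.$$ -/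

import Mathlib

open scoped TensorProduct Laplacian SchwartzMap InnerProductSpace Topology ContDiff

noncomputable section

namespace IntegerLift

open MeasureTheory Filter

/-! ### Unbounded operators: lower bounds, scalar shifts, bounded inverses, negative powers -/

section Operators

variable {H : Type*} [NormedAddCommGroup H] [InnerProductSpace ℂ H]

/-- `A ≥ ℓ` in the sense of quadratic forms: `ℓ ‖x‖² ≤ ⟪x, A x⟫` for all `x` in the domain of `A`. -/
def BoundedBelow (A : H →ₗ.[ℂ] H) (ℓ : ℝ) : Prop :=
  ∀ x : A.domain, ℓ * ‖(x : H)‖ ^ 2 ≤ (⟪(x : H), A x⟫_ℂ).re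

/-- The operator `A + c`, with the same domain as `A`. -/
def shiftOp (A : H →ₗ.[ℂ] H) (c : ℝ) : H →ₗ.[ℂ] H :=
  ((c : ℂ) • (LinearMap.id : H →ₗ[ℂ] H)) +ᵥ A

/-- `T` is an everywhere defined bounded two-sided inverse of the unbounded operator `A`. -/
def IsBoundedInverse (A : H →ₗ.[ℂ] H) (T : H →L[ℂ] H) : Prop :=
  (∀ x : A.domain, T (A x) = x) ∧ ∀ y : H, ∃ h : T y ∈ A.domain, A ⟨T y, h⟩ = y

open Classical in
/-- The bounded inverse `A⁻¹` of an unbounded operator `A` (and `0` if there is none). By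
`isBoundedInverse_invOp` below it exists whenever `A` is self-adjoint and `A ≥ ℓ > 0`. -/
def invOp (A : H →ₗ.[ℂ] H) : H →L[ℂ] H :=
  if h : ∃ T, IsBoundedInverse A T then h.choose else 0

theorem IsBoundedInverse.eq_invOp {A : H →ₗ.[ℂ] H} {T : H →L[ℂ] H} (hT : IsBoundedInverse A T) :
    invOp A = T := by
  have h : ∃ T, IsBoundedInverse A T := ⟨T, hT⟩
  have hc : invOp A = h.choose := by simp [invOp, h]
  rw [hc]
  ext y
  obtain ⟨h1, h2⟩ := hT.2 y
  have := h.choose_spec.1 ⟨T y, h1⟩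
  rwa [h2] at this

theorem BoundedBelow.norm_le {A : H →ₗ.[ℂ] H} {ℓ : ℝ} (hA : BoundedBelow A ℓ) (x : A.domain) :
    ℓ * ‖(x : H)‖ ≤ ‖A x‖ := by
  by_cases hx : ‖(x : H)‖ = 0
  · simp [hx]
  · have h1 : ℓ * ‖(x : H)‖ ^ 2 ≤ ‖(x : H)‖ * ‖A x‖ :=
      (hA x).trans ((Complex.re_le_norm _).trans (norm_inner_le_norm _ _))
    have h2 : 0 < ‖(x : H)‖ := lt_of_le_of_ne (norm_nonneg _) (Ne.symm hx)
    nlinarith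

/-- A self-adjoint operator `A ≥ ℓ > 0` has a bounded inverse. -/
theorem isBoundedInverse_invOp [CompleteSpace H] {A : H →ₗ.[ℂ] H} (hA : IsSelfAdjoint A) {ℓ : ℝ}
    (hℓ : 0 < ℓ) (hAℓ : BoundedBelow A ℓ) : IsBoundedInverse A (invOp A) := by
  have hdense := hA.dense_domain
  have hinj : Function.Injective A.toFun := by
    rw [← LinearMap.ker_eq_bot, LinearMap.ker_eq_bot']
    intro x hx
    have h := hAℓ.norm_le x
    have h0 : ‖A x‖ = 0 := by rw [norm_eq_zero]; exact hx
    rw [h0] at h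
    have : ‖(x : H)‖ = 0 := by nlinarith [norm_nonneg (x : H)]
    exact Subtype.ext (norm_eq_zero.mp this)
  have hclosed : IsClosed (LinearMap.range A.toFun : Set H) := by
    rw [← isSeqClosed_iff_isClosed]
    intro u y hu huy
    choose x hx using hu
    have hcau : CauchySeq fun n => (x n : H) := by
      have hc := huy.cauchySeq
      rw [Metric.cauchySeq_iff] at hc ⊢
      intro ε hε
      obtain ⟨N, hN⟩ := hc (ℓ * ε) (by positivity)
      refine ⟨N, fun m hm n hn => ?_⟩
      have h1 := hN m hm n hn
      have h2 := hAℓ.norm_le (x m - x n)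
      rw [dist_eq_norm] at h1 ⊢
      have h3 : A (x m - x n) = u m - u n := by
        rw [LinearPMap.map_sub, ← hx m, ← hx n]; rfl
      rw [h3] at h2
      have h4 : ((x m - x n : A.domain) : H) = (x m : H) - x n := rfl
      rw [h4] at h2
      exact lt_of_mul_lt_mul_left (h2.trans_lt h1) hℓ.le
    obtain ⟨z, hz⟩ := cauchySeq_tendsto_of_complete hcau
    have hg : (z, y) ∈ A.graph := by
      have hcl : IsClosed (A.graph : Set (H × H)) := hA.isClosed
      refine hcl.mem_of_tendsto (hz.prodMk_nhds huy) (Eventually.of_forall fun n => ?_)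
      have := A.mem_graph (x n)
      rw [← hx n]
      exact this
    obtain ⟨w, hw1, hw2⟩ := (LinearPMap.mem_graph_iff A).mp hg
    exact ⟨w, hw2⟩
  have hsurj : LinearMap.range A.toFun = ⊤ := by
    have : CompleteSpace (LinearMap.range A.toFun) := hclosed.completeSpace_coe
    rw [← Submodule.orthogonal_eq_bot_iff, Submodule.eq_bot_iff]
    intro y hy
    have hy' : ∀ x : A.domain, ⟪(0 : H), x⟫_ℂ = ⟪y, A x⟫_ℂ := by
      intro x
      rw [inner_zero_left]
      exact ((Submodule.mem_orthogonal' _ _).mp hy _ ⟨x, rfl⟩).symm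
    have hmem : y ∈ (A.adjoint).domain := LinearPMap.mem_adjoint_domain_of_exists y ⟨0, hy'⟩
    have hval : A.adjoint ⟨y, hmem⟩ = 0 :=
      LinearPMap.adjoint_apply_eq hdense ⟨y, hmem⟩ hy'
    have hg : (y, (0 : H)) ∈ A.graph := by
      have : (y, (0 : H)) ∈ (A.adjoint).graph :=
        (LinearPMap.mem_graph_iff _).mpr ⟨⟨y, hmem⟩, rfl, hval⟩
      rwa [LinearPMap.isSelfAdjoint_def.mp hA] at this
    obtain ⟨w, hw1, hw2⟩ := (LinearPMap.mem_graph_iff A).mp hg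
    have : w = 0 := hinj (by rw [map_zero]; exact hw2)
    have hw3 : (w : H) = y := hw1
    rw [← hw3, this]; rfl
  let e : A.domain ≃ₗ[ℂ] H :=
    LinearEquiv.ofBijective A.toFun ⟨hinj, LinearMap.range_eq_top.mp hsurj⟩
  have he : ∀ x, e x = A x := fun _ => rfl
  let T : H →L[ℂ] H := (A.domain.subtype ∘ₗ e.symm.toLinearMap).mkContinuous ℓ⁻¹ (by
    intro y
    have h := hAℓ.norm_le (e.symm y)
    rw [← he, e.apply_symm_apply] at h
    change ‖((e.symm y : A.domain) : H)‖ ≤ _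
    rw [inv_mul_eq_div, le_div_iff₀ hℓ]
    linarith)
  have hT : ∀ y, T y = (e.symm y : H) := fun _ => rfl
  have hinvT : IsBoundedInverse A T := by
    refine ⟨fun x => ?_, fun y => ⟨(e.symm y).2, ?_⟩⟩
    · rw [hT, ← he, e.symm_apply_apply]
    · exact e.apply_symm_apply y
  rw [hinvT.eq_invOp]
  exact hinvT

/-- The power `A^{-s}`, `s > 0`, of a self-adjoint operator `A ≥ ℓ > 0`: the function `x ↦ x ^ s`
of the bounded positive operator `A⁻¹`, in the sense of the continuous functional calculus. -/
def negPow [CompleteSpace H] (A : H →ₗ.[ℂ] H) (s : ℝ) : H →L[ℂ] H :=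
  (invOp A) ^ s

end Operators

/-! ### Hilbert tensor products and operators `A ⊗ I + I ⊗ B` -/

section Tensor

/-- The Hilbert space tensor product: the completion of the algebraic tensor product, whose inner
product is determined by `⟪x ⊗ y, x' ⊗ y'⟫ = ⟪x, x'⟫ ⟪y, y'⟫`. -/
abbrev HilbertTensor (H K : Type*) [NormedAddCommGroup H] [InnerProductSpace ℂ H]
    [NormedAddCommGroup K] [InnerProductSpace ℂ K] : Type _ :=
  UniformSpace.Completion (H ⊗[ℂ] K)

variable {H K : Type*} [NormedAddCommGroup H] [InnerProductSpace ℂ H]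
  [NormedAddCommGroup K] [InnerProductSpace ℂ K]

/-- The inclusion of the algebraic tensor product in the Hilbert space tensor product. -/
def inclTensor : H ⊗[ℂ] K →ₗ[ℂ] HilbertTensor H K :=
  (UniformSpace.Completion.toComplₗᵢ (𝕜 := ℂ) (E := H ⊗[ℂ] K)).toLinearMap

/-- The graph of `A ⊗ I + I ⊗ B` on the algebraic tensor product of the domains of `A` and `B`:
it is spanned by the pairs `(x ⊗ y, A x ⊗ y + x ⊗ B y)`. -/
def tensorSumGraph (A : H →ₗ.[ℂ] H) (B : K →ₗ.[ℂ] K) :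
    Submodule ℂ (HilbertTensor H K × HilbertTensor H K) :=
  LinearMap.range
    ((inclTensor ∘ₗ TensorProduct.map A.domain.subtype B.domain.subtype).prod
      (inclTensor ∘ₗ (TensorProduct.map A.toFun B.domain.subtype +
        TensorProduct.map A.domain.subtype B.toFun)))

/-- The operator `A ⊗ I + I ⊗ B` on `H ⊗ K`: the closure of the operator defined on the algebraic
tensor product of the domains. -/
def tensorSum (A : H →ₗ.[ℂ] H) (B : K →ₗ.[ℂ] K) :
    HilbertTensor H K →ₗ.[ℂ] HilbertTensor H K :=
  (tensorSumGraph A B).toLinearPMap.closure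

/-- `tensorSumGraph A B` is indeed the graph of an operator. -/
theorem tensorSumGraph_eq_graph (A : H →ₗ.[ℂ] H) (B : K →ₗ.[ℂ] K) :
    (tensorSumGraph A B).toLinearPMap.graph = tensorSumGraph A B := by
  refine Submodule.toLinearPMap_graph_eq _ ?_
  rintro _ ⟨t, rfl⟩ h
  have h1 : inclTensor (TensorProduct.map A.domain.subtype B.domain.subtype t) = 0 := h
  have h2 : TensorProduct.map A.domain.subtype B.domain.subtype t = 0 :=
    (UniformSpace.Completion.toComplₗᵢ (𝕜 := ℂ) (E := H ⊗[ℂ] K)).injective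
      (h1.trans (map_zero _).symm)
  have h3 : t = 0 :=
    TensorProduct.map_injective_of_flat_flat _ _ A.domain.injective_subtype
      B.domain.injective_subtype (h2.trans (map_zero _).symm)
  rw [h3]
  simp

end Tensor

/-! ### The Laplacian and mollifiers on `L²` of a Euclidean space -/

section Euclidean

variable {E : Type*} [NormedAddCommGroup E] [InnerProductSpace ℝ E] [FiniteDimensional ℝ E]
  [MeasurableSpace E] [BorelSpace E]

variable (E) in
/-- `L²(E; ℂ)` with respect to Lebesgue measure. -/
abbrev L2 : Type _ := Lp ℂ 2 (volume : Measure E)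

variable (E) in
/-- The graph of `-Δ` on `L²(E)`: pairs `(f, g)` with `-Δ f = g` in the sense of distributions. -/
def negLaplacianGraph : Submodule ℂ (L2 E × L2 E) where
  carrier := {u | -Δ (u.1 : 𝓢'(E, ℂ)) = (u.2 : 𝓢'(E, ℂ))}
  add_mem' := by
    intro u v hu hv
    simp only [Set.mem_ofPred_eq, ← Lp.toTemperedDistributionCLM_apply,
      ← TemperedDistribution.laplacianCLM_apply, Prod.fst_add, Prod.snd_add, map_add] at *
    rw [← hu, ← hv]; abel
  zero_mem' := by
    simp only [Set.mem_ofPred_eq, ← Lp.toTemperedDistributionCLM_apply,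
      ← TemperedDistribution.laplacianCLM_apply, Prod.fst_zero, Prod.snd_zero, map_zero, neg_zero]
  smul_mem' := by
    intro c u hu
    simp only [Set.mem_ofPred_eq, ← Lp.toTemperedDistributionCLM_apply,
      ← TemperedDistribution.laplacianCLM_apply, Prod.smul_fst, Prod.smul_snd, map_smul] at *
    rw [← hu, smul_neg]

variable (E) in
/-- The non-negative Laplacian `-Δ` on `L²(E)`, with domain `{f ∈ L² : Δ f ∈ L²} = H²(E)`.
For `E = ℝ` this is `-∂_z²`. -/
def negLaplacian : L2 E →ₗ.[ℂ] L2 E := (negLaplacianGraph E).toLinearPMap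

variable (E) in
/-- `negLaplacianGraph E` is indeed the graph of an operator. -/
theorem negLaplacianGraph_eq_graph : (negLaplacian E).graph = negLaplacianGraph E := by
  refine Submodule.toLinearPMap_graph_eq _ ?_
  rintro ⟨f, g⟩ h (rfl : f = 0)
  have h1 : -Δ ((0 : L2 E) : 𝓢'(E, ℂ)) = (g : 𝓢'(E, ℂ)) := h
  rw [← Lp.toTemperedDistributionCLM_apply, ← Lp.toTemperedDistributionCLM_apply,
    ← TemperedDistribution.laplacianCLM_apply, map_zero, map_zero, neg_zero] at h1
  have h2 := Lp.ker_toTemperedDistributionCLM_eq_bot (F := ℂ) (μ := (volume : Measure E)) (p := 2)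
  rw [LinearMap.ker_eq_bot'] at h2
  exact h2 g h1.symm

/-- The rescaled function `ρ_δ(z) = δ^{-m} ρ(z / δ)` on an `m`-dimensional space. -/
def rescale (ρ : E → ℂ) (δ : ℝ) (z : E) : ℂ :=
  ((δ : ℂ) ^ Module.finrank ℝ E)⁻¹ * ρ (δ⁻¹ • z)

theorem memLp_rescale {ρ : E → ℂ} (hρ : Continuous ρ) (hc : HasCompactSupport ρ) {δ : ℝ}
    (hδ : 0 < δ) : MemLp (rescale ρ δ) 2 (volume : Measure E) := by
  have h1 : Continuous (rescale ρ δ) := by unfold rescale; fun_prop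
  refine h1.memLp_of_hasCompactSupport ?_
  exact (hc.comp_smul (inv_ne_zero hδ.ne')).mul_left

open Classical in
/-- `ρ_δ` as an element of `L²(E)` (which it is by `memLp_rescale` if `ρ` is continuous with compact
support and `δ > 0`; the value is `0` if `ρ_δ` is not square integrable). -/
def rescaleL2 (ρ : E → ℂ) (δ : ℝ) : L2 E :=
  if h : MemLp (rescale ρ δ) 2 (volume : Measure E) then h.toLp _ else 0

/-- A mollifier profile: a smooth compactly supported function with integral one. -/
structure IsMollifier (ρ : E → ℂ) : Prop where
  contDiff : ContDiff ℝ ∞ ρ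
  hasCompactSupport : HasCompactSupport ρ
  integral_eq_one : ∫ z, ρ z = 1

/-- The smeared source `F ⊗ ρ_δ ∈ H ⊗ L²(E)`. -/
def smear {H : Type*} [NormedAddCommGroup H] [InnerProductSpace ℂ H] (ρ : E → ℂ) (δ : ℝ) (F : H) :
    HilbertTensor H (L2 E) :=
  inclTensor (F ⊗ₜ[ℂ] rescaleL2 ρ δ)

variable {H : Type*} [NormedAddCommGroup H] [InnerProductSpace ℂ H]

/-- The auxiliary lift `A ⊗ I + I ⊗ (-∂_z²)` on `H ⊗ L²(ℝ)`. -/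
def auxLift (A : H →ₗ.[ℂ] H) : HilbertTensor H (L2 ℝ) →ₗ.[ℂ] HilbertTensor H (L2 ℝ) :=
  tensorSum A (negLaplacian ℝ)

/-- Three-dimensional Euclidean space. -/
abbrev R3 : Type := EuclideanSpace ℝ (Fin 3)

/-- The ambient operator `L ⊗ I + I ⊗ (-Δ)` on `H ⊗ L²(ℝ³)`. -/
def ambient (L : H →ₗ.[ℂ] H) : HilbertTensor H (L2 R3) →ₗ.[ℂ] HilbertTensor H (L2 R3) :=
  tensorSum L (negLaplacian R3)

end Euclidean

end IntegerLift

end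

open IntegerLift MeasureTheory Filter

/-! Everything is a statement about the bounded positive operator `R = A⁻¹`. For `c ≥ 0` the
resolvent `(A + c)⁻¹` equals `f_c(R)` with `f_c(x) = x / (1 + c x)` (`IsBoundedInverse.shift`), so
every power `(A + c)^{-s}` is a continuous function of the single operator `R`. With `d = dim E` and
`d < 2 s`, the substitution `q ↦ √x q` gives `∫ f_{|q|²}(x)^s dq = C x^{s - d/2}`, where `C = ∫ (1 +
|q|²)^{-s} dq`. Exchanging integral and functional calculus turns this into `∫ (A + |q|²)^{-s} dq =
C A^{-(s - d/2)}` (`integral_negPow_shiftOp`). The constants are `3π/8` for `d = 1`, `s = 3` and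
`4π/3` for `d = 3`, `s = 5/2`; division by `(2π)^d` yields `3/16` and `1/(6π²)`.

The tensor sums are diagonalised by the partial Fourier transform `fiberMap`, an isometry `V` from
`H ⊗ L²(E)` into `L²(E; H)`. There `A ⊗ I + I ⊗ (-Δ)` acts in the fiber at `ξ` as `A + |2πξ|²`.
Since the fiberwise inverse is bounded, the relation `V u = M V w` passes to the closure of the
graph; this gives closability, symmetry and the lower bound. Dense range then upgrades to
surjectivity, hence to self-adjointness (`isSelfAdjoint_tensorSum`). Polynomial approximation
carries the decomposition from inverses to negative powers (`coeFn_isometry_cfc`).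

By Plancherel the smeared matrix element is `∫ |ρ̂(δξ)|² ⟪F, (A + |2πξ|²)^{-s} G⟫ dξ`. Since `ρ̂(0)
= ∫ ρ = 1`, dominated convergence gives the limit. Part (2) applies the same facts twice, because
`L_M` again satisfies the hypotheses imposed on `A`. -/

open IntegerLift MeasureTheory Filter

namespace IntegerLift

/-! ### Scalar shifts, bounded inverses and a self-adjointness criterion -/

section Operators

variable {H : Type*} [NormedAddCommGroup H] [InnerProductSpace ℂ H]

theorem shiftOp_apply {A : H →ₗ.[ℂ] H} {c : ℝ} (x : (shiftOp A c).domain) :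
    shiftOp A c x = (c : ℂ) • (x : H) + A ⟨x, x.2⟩ := rfl

theorem shiftOp_shiftOp (A : H →ₗ.[ℂ] H) (a b : ℝ) :
    shiftOp (shiftOp A a) b = shiftOp A (a + b) := by
  refine LinearPMap.ext rfl fun x h₁ h₂ => ?_
  change (b : ℂ) • x + ((a : ℂ) • x + A ⟨x, h₁⟩) = ((a + b : ℝ) : ℂ) • x + A ⟨x, h₁⟩
  rw [Complex.ofReal_add, add_smul, ← add_assoc, add_comm ((b : ℂ) • x)]

theorem BoundedBelow.shift {A : H →ₗ.[ℂ] H} {ℓ : ℝ} (hA : BoundedBelow A ℓ) (c : ℝ) :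
    BoundedBelow (shiftOp A c) (ℓ + c) := by
  intro x
  have h := hA ⟨x, x.2⟩
  have h2 : (⟪(x : H), shiftOp A c x⟫_ℂ).re = c * ‖(x : H)‖ ^ 2 + (⟪(x : H), A ⟨x, x.2⟩⟫_ℂ).re := by
    rw [shiftOp_apply, inner_add_right, inner_smul_right, inner_self_eq_norm_sq_to_K]
    simp [← Complex.ofReal_pow]
  rw [h2]
  linarith

theorem shiftOp_isFormalAdjoint {A : H →ₗ.[ℂ] H}
    (hA : A.IsFormalAdjoint A) (c : ℝ) :
    (shiftOp A c).IsFormalAdjoint (shiftOp A c) := by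
  intro x y
  rw [shiftOp_apply, shiftOp_apply, inner_add_left, inner_add_right, inner_smul_left,
    inner_smul_right, hA ⟨x, x.2⟩ ⟨y, y.2⟩, Complex.conj_ofReal]

theorem isFormalAdjoint_of_isSelfAdjoint [CompleteSpace H] {A : H →ₗ.[ℂ] H}
    (hA : IsSelfAdjoint A) : A.IsFormalAdjoint A := by
  have h := LinearPMap.adjoint_isFormalAdjoint hA.dense_domain
  rwa [LinearPMap.isSelfAdjoint_def.mp hA] at h

/-- A symmetric surjective operator which is bounded below by a positive constant is self-adjoint. -/
theorem isSelfAdjoint_of_surjective [CompleteSpace H] {A : H →ₗ.[ℂ] H} {ℓ : ℝ} (hℓ : 0 < ℓ)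
    (hb : BoundedBelow A ℓ) (hs : A.IsFormalAdjoint A) (hr : ∀ y, ∃ x : A.domain, A x = y) :
    IsSelfAdjoint A := by
  have hd : Dense (A.domain : Set H) := by
    rw [Submodule.dense_iff_topologicalClosure_eq_top, Submodule.topologicalClosure_eq_top_iff,
      Submodule.eq_bot_iff]
    intro w hw
    obtain ⟨x, rfl⟩ := hr w
    have h0 : ⟪(x : H), A x⟫_ℂ = 0 := (Submodule.mem_orthogonal _ _).mp hw _ x.2
    have h1 := hb x
    rw [h0, Complex.zero_re] at h1
    have h2 : ‖(x : H)‖ ^ 2 = 0 := le_antisymm (by nlinarith [sq_nonneg ‖(x : H)‖]) (sq_nonneg _)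
    have h3 : x = 0 := Subtype.ext (by simpa using h2)
    rw [h3, LinearPMap.map_zero]
  rw [LinearPMap.isSelfAdjoint_def]
  have hle := LinearPMap.IsFormalAdjoint.le_adjoint hd hs
  refine (LinearPMap.eq_of_le_of_domain_eq hle (le_antisymm hle.1 fun y hy => ?_)).symm
  obtain ⟨x, hx⟩ := hr (A.adjoint ⟨y, hy⟩)
  -- Here `A x = A* y`, so `y - x` is orthogonal to the range of `A`. As the range is everything,
  -- pairing with `y - x = A z` itself forces `y = x`.
  obtain ⟨z, hz⟩ := hr (y - x)
  have h1 := LinearPMap.adjoint_isFormalAdjoint hd ⟨y, hy⟩ z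
  rw [← hx, hs x z] at h1
  have h2 : ⟪y - x, y - x⟫_ℂ = 0 := by
    conv_lhs => rw [← hz]
    rw [hz, inner_sub_left]
    have : ⟪(x : H), A z⟫_ℂ = ⟪y, A z⟫_ℂ := h1
    rw [← hz, this, sub_self]
  have h3 : y = x := sub_eq_zero.mp (inner_self_eq_zero.mp h2)
  rw [h3]
  exact x.2

theorem IsBoundedInverse.isPositive {A : H →ₗ.[ℂ] H} {T : H →L[ℂ] H} (hT : IsBoundedInverse A T)
    {ℓ : ℝ} (hℓ : 0 ≤ ℓ) (hb : BoundedBelow A ℓ) (hs : A.IsFormalAdjoint A) : T.IsPositive := by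
  refine ⟨fun x y => ?_, fun x => ?_⟩
  · obtain ⟨hx, hx'⟩ := hT.2 x
    obtain ⟨hy, hy'⟩ := hT.2 y
    have := hs ⟨T x, hx⟩ ⟨T y, hy⟩
    rw [hx', hy'] at this
    exact this.symm
  · obtain ⟨hx, hx'⟩ := hT.2 x
    have := hb ⟨T x, hx⟩
    rw [hx'] at this
    have h2 : 0 ≤ (⟪T x, x⟫_ℂ).re := le_trans (by positivity) this
    exact h2

theorem IsBoundedInverse.norm_le {A : H →ₗ.[ℂ] H} {T : H →L[ℂ] H} (hT : IsBoundedInverse A T)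
    {ℓ : ℝ} (hℓ : 0 < ℓ) (hb : BoundedBelow A ℓ) : ‖T‖ ≤ ℓ⁻¹ := by
  refine T.opNorm_le_bound (by positivity) fun y => ?_
  obtain ⟨hy, hy'⟩ := hT.2 y
  have := hb.norm_le ⟨T y, hy⟩
  rw [hy'] at this
  rw [inv_mul_eq_div, le_div_iff₀ hℓ]
  linarith

theorem IsBoundedInverse.sq_norm_le {A : H →ₗ.[ℂ] H} {T : H →L[ℂ] H} (hT : IsBoundedInverse A T)
    {ℓ : ℝ} (hb : BoundedBelow A ℓ) (y : H) : ℓ * ‖T y‖ ^ 2 ≤ (⟪T y, y⟫_ℂ).re := by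
  obtain ⟨hy, hy'⟩ := hT.2 y
  have := hb ⟨T y, hy⟩
  rwa [hy'] at this

variable [CompleteSpace H]

theorem spectrum_subset_Icc {T : H →L[ℂ] H} (hT : 0 ≤ T) {b : ℝ} (hb : ‖T‖ ≤ b) :
    spectrum ℝ T ⊆ Set.Icc 0 b := by
  intro x hx
  have h0 := spectrum_nonneg_of_nonneg hT hx
  -- Bounding the spectrum by the norm uses `‖1‖ = 1`, which fails on the zero space; there the
  -- spectrum is empty.
  rcases subsingleton_or_nontrivial H with h | h
  · exact absurd hx (by
      have : Subsingleton (H →L[ℂ] H) := inferInstance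
      rw [spectrum.of_subsingleton]; simp)
  · have h1 := spectrum.norm_le_norm_of_mem hx
    rw [Real.norm_eq_abs, abs_of_nonneg h0] at h1
    exact ⟨h0, h1.trans hb⟩

/-- The bounded inverse of `A + c` is the function `x / (1 + c x)` of the bounded inverse of `A`. -/
theorem IsBoundedInverse.shift {A : H →ₗ.[ℂ] H} {R : H →L[ℂ] H} (hR : IsBoundedInverse A R)
    (hR0 : 0 ≤ R) {c : ℝ} (hc : 0 ≤ c) :
    IsBoundedInverse (shiftOp A c) (cfc (fun x : ℝ => x / (1 + c * x)) R) := by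
  have hsa : IsSelfAdjoint R := .of_nonneg hR0
  have hne : ∀ x ∈ spectrum ℝ R, 1 + c * x ≠ 0 := fun x hx => by
    have := spectrum_nonneg_of_nonneg hR0 hx
    positivity
  have hcont : ContinuousOn (fun x : ℝ => (1 + c * x)⁻¹) (spectrum ℝ R) :=
    ContinuousOn.inv₀ (by fun_prop) hne
  -- `D = (1 + c R)⁻¹`, and formally `(A + c)⁻¹ = R D = D R`. The form `D R` serves as a left
  -- inverse; `R D` has range in the domain of `A` and serves as a right inverse.
  set D := cfc (fun x : ℝ => (1 + c * x)⁻¹) R with hD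
  have hT : cfc (fun x : ℝ => x / (1 + c * x)) R = D * R := by
    have := cfc_mul (fun x : ℝ => (1 + c * x)⁻¹) (fun x => x) R hcont (by fun_prop)
    rw [cfc_id' ℝ R hsa] at this
    rw [hD, ← this]
    exact congrArg (fun f => cfc f R) (funext fun x => by rw [div_eq_inv_mul])
  have hT' : cfc (fun x : ℝ => x / (1 + c * x)) R = R * D := by
    have := cfc_mul (fun x => x) (fun x : ℝ => (1 + c * x)⁻¹) R (by fun_prop) hcont
    rw [cfc_id' ℝ R hsa] at this
    rw [hD, ← this]
    exact congrArg (fun f => cfc f R) (funext fun x => by rw [div_eq_mul_inv])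
  have h1 : cfc (fun x : ℝ => 1 + c * x) R = 1 + (c : ℂ) • R := by
    rw [cfc_add R (fun _ => (1 : ℝ)) (fun x => c * x) (by fun_prop) (by fun_prop), cfc_const_one ℝ R,
      cfc_const_mul c (fun x => x) R (by fun_prop), cfc_id' ℝ R]
    rfl
  have hDl : D * (1 + (c : ℂ) • R) = 1 := by
    rw [← h1, hD, ← cfc_mul _ _ _ hcont (by fun_prop), ← cfc_const_one ℝ R]
    exact cfc_congr fun x hx => inv_mul_cancel₀ (hne x hx)
  have hDr : (1 + (c : ℂ) • R) * D = 1 := by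
    rw [← h1, hD, ← cfc_mul _ _ _ (by fun_prop) hcont, ← cfc_const_one ℝ R]
    exact cfc_congr fun x hx => mul_inv_cancel₀ (hne x hx)
  refine ⟨fun x => ?_, fun y => ?_⟩
  · have h2 := congrArg (fun S : H →L[ℂ] H => S (x : H)) hDl
    have h3 := hR.1 ⟨x, x.2⟩
    rw [shiftOp_apply, hT]
    simp only [mul_apply_eq_comp, add_apply,
      one_apply_eq_self, smul_apply, map_add, map_smul] at h2 ⊢
    rw [h3, add_comm]
    exact h2
  · obtain ⟨hy, hy'⟩ := hR.2 (D y)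
    have h2 := congrArg (fun S : H →L[ℂ] H => S y) hDr
    rw [hT']
    refine ⟨hy, ?_⟩
    have : shiftOp A c ⟨R (D y), hy⟩ = (c : ℂ) • R (D y) + A ⟨R (D y), hy⟩ := rfl
    refine this.trans ?_
    rw [hy', add_comm]
    exact h2

end Operators

/-! ### Resolvents and negative powers as functions of `A⁻¹` -/

section Positive

variable {H : Type*} [NormedAddCommGroup H] [InnerProductSpace ℂ H] [CompleteSpace H]
  {A : H →ₗ.[ℂ] H} {ℓ : ℝ}

theorem invOp_nonneg (hA : IsSelfAdjoint A) (hℓ : 0 < ℓ) (hb : BoundedBelow A ℓ) :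
    0 ≤ invOp A :=
  (ContinuousLinearMap.nonneg_iff_isPositive _).mpr <|
    (isBoundedInverse_invOp hA hℓ hb).isPositive hℓ.le hb (isFormalAdjoint_of_isSelfAdjoint hA)

theorem spectrum_invOp_subset (hA : IsSelfAdjoint A) (hℓ : 0 < ℓ) (hb : BoundedBelow A ℓ) :
    spectrum ℝ (invOp A) ⊆ Set.Icc 0 ℓ⁻¹ :=
  spectrum_subset_Icc (invOp_nonneg hA hℓ hb) ((isBoundedInverse_invOp hA hℓ hb).norm_le hℓ hb)

theorem invOp_shiftOp (hA : IsSelfAdjoint A) (hℓ : 0 < ℓ) (hb : BoundedBelow A ℓ) {c : ℝ}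
    (hc : 0 ≤ c) :
    invOp (shiftOp A c) = cfc (fun x : ℝ => x / (1 + c * x)) (invOp A) :=
  ((isBoundedInverse_invOp hA hℓ hb).shift (invOp_nonneg hA hℓ hb) hc).eq_invOp

/-- The inverse comes from the functional calculus formula, without self-adjointness of `A + c`; the
latter is itself deduced from this inverse in `isSelfAdjoint_shiftOp`. -/
theorem isBoundedInverse_invOp_shiftOp (hA : IsSelfAdjoint A) (hℓ : 0 < ℓ)
    (hb : BoundedBelow A ℓ) {c : ℝ} (hc : 0 ≤ c) :
    IsBoundedInverse (shiftOp A c) (invOp (shiftOp A c)) := by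
  rw [invOp_shiftOp hA hℓ hb hc]
  exact (isBoundedInverse_invOp hA hℓ hb).shift (invOp_nonneg hA hℓ hb) hc

theorem invOp_shiftOp_nonneg (hA : IsSelfAdjoint A) (hℓ : 0 < ℓ) (hb : BoundedBelow A ℓ) {c : ℝ}
    (hc : 0 ≤ c) : 0 ≤ invOp (shiftOp A c) :=
  (ContinuousLinearMap.nonneg_iff_isPositive _).mpr <|
    (isBoundedInverse_invOp_shiftOp hA hℓ hb hc).isPositive (by positivity) (hb.shift c)
      (shiftOp_isFormalAdjoint (isFormalAdjoint_of_isSelfAdjoint hA) c)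

theorem norm_invOp_shiftOp_le (hA : IsSelfAdjoint A) (hℓ : 0 < ℓ) (hb : BoundedBelow A ℓ) {c : ℝ}
    (hc : 0 ≤ c) : ‖invOp (shiftOp A c)‖ ≤ (ℓ + c)⁻¹ :=
  (isBoundedInverse_invOp_shiftOp hA hℓ hb hc).norm_le (by positivity) (hb.shift c)

theorem spectrum_invOp_shiftOp_subset (hA : IsSelfAdjoint A) (hℓ : 0 < ℓ) (hb : BoundedBelow A ℓ)
    {c : ℝ} (hc : 0 ≤ c) : spectrum ℝ (invOp (shiftOp A c)) ⊆ Set.Icc 0 ℓ⁻¹ :=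
  spectrum_subset_Icc (invOp_shiftOp_nonneg hA hℓ hb hc)
    ((norm_invOp_shiftOp_le hA hℓ hb hc).trans (by gcongr; linarith))

theorem negPow_shiftOp (hA : IsSelfAdjoint A) (hℓ : 0 < ℓ) (hb : BoundedBelow A ℓ) {c : ℝ}
    (hc : 0 ≤ c) {s : ℝ} (hs : 0 ≤ s) :
    negPow (shiftOp A c) s = cfc (fun x : ℝ => (x / (1 + c * x)) ^ s) (invOp A) := by
  have h0 := invOp_nonneg hA hℓ hb
  rw [negPow, CFC.rpow_eq_cfc_real (invOp_shiftOp_nonneg hA hℓ hb hc), invOp_shiftOp hA hℓ hb hc,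
    ← cfc_comp' (fun x : ℝ => x ^ s) (fun x : ℝ => x / (1 + c * x)) (invOp A)
      (Real.continuous_rpow_const hs).continuousOn ?_ (.of_nonneg h0)]
  refine ContinuousOn.div (by fun_prop) (by fun_prop) fun x hx => ?_
  have := spectrum_nonneg_of_nonneg h0 hx
  positivity

theorem negPow_eq_cfc (hA : IsSelfAdjoint A) (hℓ : 0 < ℓ) (hb : BoundedBelow A ℓ) (s : ℝ) :
    negPow A s = cfc (fun x : ℝ => x ^ s) (invOp A) :=
  CFC.rpow_eq_cfc_real (invOp_nonneg hA hℓ hb)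

theorem negPow_one (hA : IsSelfAdjoint A) (hℓ : 0 < ℓ) (hb : BoundedBelow A ℓ) :
    negPow A 1 = invOp A :=
  CFC.rpow_one _ (invOp_nonneg hA hℓ hb)

theorem invOp_pow_three (hA : IsSelfAdjoint A) (hℓ : 0 < ℓ) (hb : BoundedBelow A ℓ) :
    invOp A ^ 3 = negPow A 3 := by
  have := CFC.rpow_natCast (invOp A) 3 (invOp_nonneg hA hℓ hb)
  rw [negPow, ← this]
  norm_num

theorem invOp_shiftOp_pow_three (hA : IsSelfAdjoint A) (hℓ : 0 < ℓ) (hb : BoundedBelow A ℓ) {c : ℝ}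
    (hc : 0 ≤ c) : invOp (shiftOp A c) ^ 3 = negPow (shiftOp A c) 3 := by
  have := CFC.rpow_natCast (invOp (shiftOp A c)) 3 (invOp_shiftOp_nonneg hA hℓ hb hc)
  rw [negPow, ← this]
  norm_num

end Positive

/-! ### Scalar integrals and their constants -/

section ScalarIntegrals

variable {E : Type*} [NormedAddCommGroup E] [InnerProductSpace ℝ E] [FiniteDimensional ℝ E]
  [MeasurableSpace E] [BorelSpace E]

/-- Comparison with the case `m = 1` through `m + |q|² ≥ min(m, 1) (1 + |q|²)`. -/
theorem integrable_add_norm_sq_rpow_neg {m s : ℝ} (hm : 0 < m)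
    (hs : (Module.finrank ℝ E : ℝ) < 2 * s) :
    Integrable (fun q : E => (m + ‖q‖ ^ 2) ^ (-s)) := by
  have hs0 : 0 ≤ s := by
    have : (0 : ℝ) ≤ Module.finrank ℝ E := Nat.cast_nonneg _
    linarith
  have h := (integrable_rpow_neg_one_add_norm_sq (μ := (volume : Measure E)) hs).const_mul
    ((min m 1) ^ (-s))
  refine h.mono' (Measurable.aestronglyMeasurable (by fun_prop)) (Eventually.of_forall fun q => ?_)
  have hm1 : 0 < min m 1 := lt_min hm one_pos
  have h1 : min m 1 * (1 + ‖q‖ ^ 2) ≤ m + ‖q‖ ^ 2 := by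
    nlinarith [min_le_left m 1, min_le_right m 1, sq_nonneg ‖q‖]
  rw [Real.norm_of_nonneg (by positivity), show -(2 * s) / 2 = -s by ring,
    ← Real.mul_rpow (by positivity) (by positivity)]
  exact Real.rpow_le_rpow_of_nonpos (by positivity) h1 (by linarith)

theorem div_one_add_mul_le {ℓ c x : ℝ} (hℓ : 0 < ℓ) (hc : 0 ≤ c) (hx : x ∈ Set.Icc 0 ℓ⁻¹) :
    x / (1 + c * x) ≤ (ℓ + c)⁻¹ := by
  obtain ⟨h0, h1⟩ := hx
  have h2 : x * ℓ ≤ 1 := by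
    have := mul_le_mul_of_nonneg_right h1 hℓ.le
    rwa [inv_mul_cancel₀ hℓ.ne'] at this
  rw [div_le_iff₀ (by positivity), inv_mul_eq_div, le_div_iff₀ (by positivity)]
  linarith

/-- For `x > 0` the integrand is `x^s` times the `x = 1` profile at `√x q`, and the dilation costs a
Jacobian `x^{-d/2}`. The value `x = 0` must be covered since it may lie in the spectrum of `A⁻¹`;
both sides vanish there because `s` and `s - d/2` are positive. -/
theorem integral_div_one_add_norm_sq_mul_rpow {s x : ℝ} (hx : 0 ≤ x)
    (hs : (Module.finrank ℝ E : ℝ) < 2 * s) :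
    ∫ q : E, (x / (1 + ‖q‖ ^ 2 * x)) ^ s
      = (∫ q : E, (1 + ‖q‖ ^ 2) ^ (-s)) * x ^ (s - Module.finrank ℝ E / 2) := by
  have hd : (0 : ℝ) ≤ Module.finrank ℝ E := Nat.cast_nonneg _
  rcases hx.eq_or_lt with rfl | hx
  · rw [Real.zero_rpow (by linarith)]
    simp [Real.zero_rpow (show s ≠ 0 by linarith)]
  have h1 : ∀ q : E, (x / (1 + ‖q‖ ^ 2 * x)) ^ s
      = x ^ s * (fun q : E => (1 + ‖q‖ ^ 2) ^ (-s)) (√x • q) := by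
    intro q
    have h2 : ‖√x • q‖ ^ 2 = ‖q‖ ^ 2 * x := by
      rw [norm_smul, mul_pow, Real.norm_of_nonneg (Real.sqrt_nonneg x), Real.sq_sqrt hx.le, mul_comm]
    simp only [h2]
    rw [Real.div_rpow hx.le (by positivity), Real.rpow_neg (by positivity), div_eq_mul_inv]
  simp_rw [h1]
  rw [integral_const_mul,
    Measure.integral_comp_smul volume (fun q : E => (1 + ‖q‖ ^ 2) ^ (-s)) √x, smul_eq_mul, abs_of_nonneg (by positivity),
    Real.rpow_sub hx, Real.sqrt_eq_rpow, ← Real.rpow_natCast, ← Real.rpow_mul hx.le,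
    show (1 / 2 * (Module.finrank ℝ E : ℝ)) = Module.finrank ℝ E / 2 by ring]
  ring

theorem integral_inv_one_add_sq_pow_three :
    ∫ p : ℝ, (1 + ‖p‖ ^ 2) ^ (-(3 : ℝ)) = 3 * Real.pi / 8 := by
  have h1 : ∀ p : ℝ, (1 + ‖p‖ ^ 2) ^ (-(3 : ℝ)) = ((1 + p ^ 2) ^ 3)⁻¹ := fun p => by
    rw [Real.rpow_neg (by positivity), Real.norm_eq_abs, sq_abs]
    norm_cast
  have hint : Integrable (fun p : ℝ => ((1 + p ^ 2) ^ 3)⁻¹) := by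
    simp_rw [← h1]
    exact integrable_add_norm_sq_rpow_neg one_pos (by norm_num [Module.finrank_self])
  simp_rw [h1]
  -- Antiderivative from the usual reduction formula. Its rational terms vanish at `±∞`, so only
  -- `(3/8) arctan` contributes, giving `3π/8`.
  have hder : ∀ p : ℝ, HasDerivAt (fun p : ℝ => p / 4 * ((1 + p ^ 2) ^ 2)⁻¹
      + 3 / 8 * (p * (1 + p ^ 2)⁻¹) + 3 / 8 * Real.arctan p) (((1 + p ^ 2) ^ 3)⁻¹) p := by
    intro p
    have hp : (1 + p ^ 2) ≠ 0 := by positivity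
    have h2 : HasDerivAt (fun p : ℝ => 1 + p ^ 2) (2 * p) p := by
      simpa using (hasDerivAt_pow 2 p).const_add 1
    convert! ((((hasDerivAt_id p).div_const 4).mul ((h2.pow 2).inv (pow_ne_zero 2 hp))).add
      (((hasDerivAt_id p).mul (h2.inv hp)).const_mul (3 / 8))).add
      ((Real.hasDerivAt_arctan p).const_mul (3 / 8)) using 1
    simp only [id, Pi.pow_apply, Pi.inv_apply]
    field_simp
    ring
  have hb : ∀ p : ℝ, |p * (1 + p ^ 2)⁻¹| ≤ |p|⁻¹ := by
    intro p
    rcases eq_or_ne p 0 with rfl | hp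
    · simp
    have : 0 < |p| := abs_pos.mpr hp
    rw [abs_mul, abs_inv, abs_of_pos (show (0 : ℝ) < 1 + p ^ 2 by positivity), ← sq_abs p,
      ← div_eq_mul_inv, div_le_iff₀ (by positivity)]
    field_simp
    linarith
  have hb' : ∀ p : ℝ, |p / 4 * ((1 + p ^ 2) ^ 2)⁻¹| ≤ |p|⁻¹ := by
    intro p
    refine le_trans ?_ (hb p)
    rw [abs_mul, abs_mul, abs_inv, abs_inv, abs_of_pos (show (0 : ℝ) < 1 + p ^ 2 by positivity),
      abs_of_pos (show (0 : ℝ) < (1 + p ^ 2) ^ 2 by positivity), abs_div]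
    gcongr
    · norm_num
      linarith [abs_nonneg p]
    · nlinarith [sq_nonneg p]
  have hlim : ∀ l : Filter ℝ, Tendsto (fun p : ℝ => |p|⁻¹) l (𝓝 0) → ∀ a,
      Tendsto Real.arctan l (𝓝 a) →
      Tendsto (fun p : ℝ => p / 4 * ((1 + p ^ 2) ^ 2)⁻¹
      + 3 / 8 * (p * (1 + p ^ 2)⁻¹) + 3 / 8 * Real.arctan p) l (𝓝 (3 / 8 * a)) := by
    intro l hl a ha
    have h3 := ((squeeze_zero_norm hb' hl).add
      ((squeeze_zero_norm hb hl).const_mul (3 / 8))).add (ha.const_mul (3 / 8))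
    simpa using h3
  rw [integral_of_hasDerivAt_of_tendsto hder hint
    (hlim atBot (tendsto_inv_atTop_zero.comp tendsto_abs_atBot_atTop) _
      (tendsto_nhds_of_tendsto_nhdsWithin Real.tendsto_arctan_atBot))
    (hlim atTop (tendsto_inv_atTop_zero.comp tendsto_abs_atTop_atTop) _
      (tendsto_nhds_of_tendsto_nhdsWithin Real.tendsto_arctan_atTop))]
  ring

theorem integral_Ioi_sq_mul_one_add_sq_rpow :
    ∫ r in Set.Ioi (0 : ℝ), r ^ 2 * (1 + r ^ 2) ^ (-(5 / 2 : ℝ)) = 1 / 3 := by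
  have hder : ∀ r ∈ Set.Ici (0 : ℝ), HasDerivAt (fun r : ℝ => 1 / 3 * (r ^ 3 * (1 + r ^ 2) ^ (-(3 / 2 : ℝ))))
      (r ^ 2 * (1 + r ^ 2) ^ (-(5 / 2 : ℝ))) r := by
    intro r _
    have hp : (1 + r ^ 2) ≠ 0 := by positivity
    have h2 : HasDerivAt (fun p : ℝ => 1 + p ^ 2) (2 * r) r := by
      simpa using (hasDerivAt_pow 2 r).const_add 1
    have h3 := (((hasDerivAt_pow 3 r).mul (h2.rpow_const (p := -(3 / 2 : ℝ)) (Or.inl hp))).const_mul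
      (1 / 3))
    convert! h3 using 1
    have h4 : (1 + r ^ 2) ^ (-(3 / 2 : ℝ)) = (1 + r ^ 2) ^ (-(5 / 2 : ℝ)) * (1 + r ^ 2) := by
      conv_rhs => rw [← Real.rpow_add_one hp]
      norm_num
    rw [h4, show (-(3 / 2 : ℝ)) - 1 = -(5 / 2) by norm_num]
    push_cast
    ring
  have hlim : Tendsto (fun r : ℝ => 1 / 3 * (r ^ 3 * (1 + r ^ 2) ^ (-(3 / 2 : ℝ)))) atTop
      (𝓝 (1 / 3)) := by
    -- For `r > 0`, `r³ (1 + r²)^{-3/2} = (r⁻² + 1)^{-3/2}`, whose limit at infinity is visible.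
    have h1 : Tendsto (fun r : ℝ => 1 / 3 * ((r⁻¹) ^ 2 + 1) ^ (-(3 / 2 : ℝ))) atTop
        (𝓝 (1 / 3 * ((0 : ℝ) ^ 2 + 1) ^ (-(3 / 2 : ℝ)))) := by
      refine Tendsto.const_mul _ (Tendsto.rpow_const ?_ (Or.inl (by norm_num)))
      exact (tendsto_inv_atTop_zero.pow 2).add_const 1
    norm_num at h1
    refine Tendsto.congr' ?_ (by simpa using h1)
    filter_upwards [eventually_gt_atTop 0] with r hr
    have h5 : (1 + r ^ 2) = r ^ 2 * ((r⁻¹) ^ 2 + 1) := by field_simp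
    have h6 : (r ^ 2) ^ (-(3 / 2 : ℝ)) = (r ^ 3)⁻¹ := by
      rw [← Real.rpow_natCast, ← Real.rpow_mul hr.le, ← Real.rpow_natCast, ← Real.rpow_neg hr.le]
      norm_num
    rw [h5, Real.mul_rpow (by positivity) (by positivity), h6]
    field_simp
  rw [integral_Ioi_of_hasDerivAt_of_nonneg' hder (fun r _ => by positivity) hlim]
  norm_num

/-- Polar coordinates: dimension `3`, times the ball volume `4π/3`, times the radial integral `1/3`.
-/
theorem integral_one_add_norm_sq_rpow_R3 :
    ∫ q : R3, (1 + ‖q‖ ^ 2) ^ (-(5 / 2 : ℝ)) = 4 * Real.pi / 3 := by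
  rw [integral_fun_norm_addHaar volume (fun r : ℝ => (1 + r ^ 2) ^ (-(5 / 2 : ℝ)))]
  have h1 : (volume : Measure R3).real (Metric.ball 0 1) = 4 * Real.pi / 3 := by
    rw [Measure.real, EuclideanSpace.volume_ball_fin_three]
    rw [ENNReal.ofReal_one, one_pow, one_mul, ENNReal.toReal_ofReal (by positivity)]
    ring
  simp only [finrank_euclideanSpace_fin, smul_eq_mul, nsmul_eq_mul]
  norm_num only
  rw [integral_Ioi_sq_mul_one_add_sq_rpow, h1]
  ring

end ScalarIntegrals

/-! ### Operator-norm integrals of shifted negative powers -/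

section OperatorIntegrals

variable {H : Type*} [NormedAddCommGroup H] [InnerProductSpace ℂ H] [CompleteSpace H]
  {A : H →ₗ.[ℂ] H} {ℓ : ℝ}

theorem continuousOn_uncurry_div_one_add_mul_rpow {X : Type*} [TopologicalSpace X] {φ : X → ℝ}
    (hφ : Continuous φ) (hφ0 : ∀ x, 0 ≤ φ x) {s : ℝ} (hs : 0 ≤ s) :
    ContinuousOn (Function.uncurry fun (x : X) (r : ℝ) => (r / (1 + φ x * r)) ^ s)
      (Set.univ ×ˢ Set.Ici 0) := by
  refine ContinuousOn.rpow_const (ContinuousOn.div (by fun_prop) (by fun_prop) ?_)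
    fun _ _ => Or.inr hs
  rintro ⟨x, r⟩ ⟨-, hr⟩
  have h1 : (0 : ℝ) ≤ r := hr
  have := hφ0 x
  simp only
  positivity

theorem norm_div_one_add_mul_rpow_le {c x s : ℝ} (hℓ : 0 < ℓ) (hc : 0 ≤ c) (hs : 0 ≤ s)
    (hx : x ∈ Set.Icc 0 ℓ⁻¹) : ‖(x / (1 + c * x)) ^ s‖ ≤ (ℓ + c) ^ (-s) := by
  have h1 : 0 ≤ x := hx.1
  rw [Real.norm_of_nonneg (by positivity), Real.rpow_neg (by positivity), ← Real.inv_rpow (by positivity)]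
  exact Real.rpow_le_rpow (by positivity) (div_one_add_mul_le hℓ hc hx) hs

/-- Joint continuity makes the parameter a measurable map into the continuous functions on the
spectrum of `A⁻¹`; the functional calculus is continuous on that space. -/
theorem aestronglyMeasurable_negPow_shiftOp_comp {X : Type*} [TopologicalSpace X]
    [SecondCountableTopology X] [MeasurableSpace X] [OpensMeasurableSpace X] {μ : Measure X}
    (hA : IsSelfAdjoint A) (hℓ : 0 < ℓ) (hb : BoundedBelow A ℓ) {φ : X → ℝ}
    (hφ : Continuous φ) (hφ0 : ∀ x, 0 ≤ φ x) {s : ℝ} (hs : 0 ≤ s) :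
    AEStronglyMeasurable (fun x => negPow (shiftOp A (φ x)) s) μ := by
  have hsa : IsSelfAdjoint (invOp A) := .of_nonneg (invOp_nonneg hA hℓ hb)
  simp_rw [fun x => negPow_shiftOp hA hℓ hb (hφ0 x) hs, fun x => cfc_eq_cfcL_mkD (R := ℝ)
    (fun r : ℝ => (r / (1 + φ x * r)) ^ s) (invOp A) hsa]
  exact (cfcL (R := ℝ) hsa).continuous.comp_aestronglyMeasurable
    (ContinuousMap.aeStronglyMeasurable_mkD_restrict_of_uncurry
      (fun (x : X) (r : ℝ) => (r / (1 + φ x * r)) ^ s) _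
      ((continuousOn_uncurry_div_one_add_mul_rpow hφ hφ0 hs).mono
        (Set.prod_mono_right fun r hr => (spectrum_invOp_subset hA hℓ hb hr).1)))

theorem norm_negPow_shiftOp_le (hA : IsSelfAdjoint A) (hℓ : 0 < ℓ) (hb : BoundedBelow A ℓ) {c s : ℝ}
    (hc : 0 ≤ c) (hs : 0 ≤ s) : ‖negPow (shiftOp A c) s‖ ≤ (ℓ + c) ^ (-s) := by
  rw [negPow_shiftOp hA hℓ hb hc hs]
  exact norm_cfc_le (by positivity) fun z hz =>
    norm_div_one_add_mul_rpow_le hℓ hc hs (spectrum_invOp_subset hA hℓ hb hz)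

theorem integrable_negPow_shiftOp_comp {X : Type*} [TopologicalSpace X]
    [SecondCountableTopology X] [MeasurableSpace X] [OpensMeasurableSpace X] {μ : Measure X}
    (hA : IsSelfAdjoint A) (hℓ : 0 < ℓ) (hb : BoundedBelow A ℓ) {φ : X → ℝ}
    (hφ : Continuous φ) (hφ0 : ∀ x, 0 ≤ φ x) {s : ℝ} (hs : 0 ≤ s)
    (hint : Integrable (fun x => (ℓ + φ x) ^ (-s)) μ) :
    Integrable (fun x => negPow (shiftOp A (φ x)) s) μ := by
  exact hint.mono' (aestronglyMeasurable_negPow_shiftOp_comp hA hℓ hb hφ hφ0 hs)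
    (.of_forall fun x => norm_negPow_shiftOp_le hA hℓ hb (hφ0 x) hs)

variable {E : Type*} [NormedAddCommGroup E] [InnerProductSpace ℝ E] [FiniteDimensional ℝ E]
  [MeasurableSpace E] [BorelSpace E]

theorem integrable_negPow_shiftOp (hA : IsSelfAdjoint A) (hℓ : 0 < ℓ) (hb : BoundedBelow A ℓ)
    {s : ℝ} (hs : (Module.finrank ℝ E : ℝ) < 2 * s) :
    Integrable (fun q : E => negPow (shiftOp A (‖q‖ ^ 2)) s) := by
  have hd : (0 : ℝ) ≤ Module.finrank ℝ E := Nat.cast_nonneg _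
  exact integrable_negPow_shiftOp_comp hA hℓ hb (by fun_prop) (fun _ => by positivity)
    (by linarith) (integrable_add_norm_sq_rpow_neg hℓ hs)

variable (E) in
theorem integral_negPow_shiftOp (hA : IsSelfAdjoint A) (hℓ : 0 < ℓ) (hb : BoundedBelow A ℓ)
    {s : ℝ} (hs : (Module.finrank ℝ E : ℝ) < 2 * s) :
    ∫ q : E, negPow (shiftOp A (‖q‖ ^ 2)) s
      = ((∫ q : E, (1 + ‖q‖ ^ 2) ^ (-s) : ℝ) : ℂ) • negPow A (s - Module.finrank ℝ E / 2) := by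
  have hd : (0 : ℝ) ≤ Module.finrank ℝ E := Nat.cast_nonneg _
  have hs0 : 0 ≤ s := by linarith
  have h0 := invOp_nonneg hA hℓ hb
  have hsp := spectrum_invOp_subset hA hℓ hb
  simp_rw [fun q : E => negPow_shiftOp hA hℓ hb (sq_nonneg ‖q‖) hs0]
  -- The integral moves inside the functional calculus, dominated uniformly on the spectrum by `(ℓ +
  -- |q|²)^{-s}`; the scalar scaling identity then applies pointwise.
  rw [← cfc_integral (𝕜 := ℝ) (fun (q : E) (x : ℝ) => (x / (1 + ‖q‖ ^ 2 * x)) ^ s)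
    (fun q => (ℓ + ‖q‖ ^ 2) ^ (-s)) (invOp A)
    ((continuousOn_uncurry_div_one_add_mul_rpow (by fun_prop) (fun q : E => sq_nonneg ‖q‖) hs0).mono
      (Set.prod_mono_right fun r hr => (hsp hr).1))
    (.of_forall fun q z hz => norm_div_one_add_mul_rpow_le hℓ (sq_nonneg ‖q‖) hs0 (hsp hz))
    (integrable_add_norm_sq_rpow_neg hℓ hs).2 (.of_nonneg h0),
    cfc_congr fun x hx => integral_div_one_add_norm_sq_mul_rpow (hsp hx).1 hs,
    cfc_const_mul _ _ _ (Real.continuous_rpow_const (by linarith)).continuousOn,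
    negPow_eq_cfc hA hℓ hb]
  rfl

end OperatorIntegrals

/-! ### The Laplacian as a Fourier multiplier on `L²` -/

section Fourier

open TemperedDistribution FourierTransform

variable {E : Type*} [NormedAddCommGroup E] [InnerProductSpace ℝ E]

/-- The symbol of `-Δ` for the normalisation `exp (-2 π i ⟪x, ξ⟫)` of the Fourier transform. -/
noncomputable def lapSymbol (ξ : E) : ℝ := ‖(2 * Real.pi) • ξ‖ ^ 2

theorem lapSymbol_nonneg (ξ : E) : 0 ≤ lapSymbol ξ := sq_nonneg _

@[fun_prop]
theorem continuous_lapSymbol : Continuous (lapSymbol : E → ℝ) := by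
  unfold lapSymbol; fun_prop

theorem hasTemperateGrowth_lapSymbol :
    (fun ξ : E => ((lapSymbol ξ : ℝ) : ℂ)).HasTemperateGrowth := by
  unfold lapSymbol
  simp_rw [norm_smul, mul_pow]
  fun_prop

theorem hasTemperateGrowth_one_add_lapSymbol :
    (fun ξ : E => ((1 + lapSymbol ξ : ℝ) : ℂ)).HasTemperateGrowth := by
  unfold lapSymbol
  simp_rw [norm_smul, mul_pow]
  fun_prop

theorem hasTemperateGrowth_inv_one_add_lapSymbol :
    (fun ξ : E => (((1 + lapSymbol ξ)⁻¹ : ℝ) : ℂ)).HasTemperateGrowth := by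
  have h : (fun ξ : E => (1 + ‖(2 * Real.pi) • ξ‖ ^ 2) ^ (-1 : ℝ)).HasTemperateGrowth :=
    (Function.hasTemperateGrowth_one_add_norm_sq_rpow E (-1)).comp
      (((2 * Real.pi) • ContinuousLinearMap.id ℝ E).hasTemperateGrowth)
  simp_rw [Real.rpow_neg_one] at h
  unfold lapSymbol
  fun_prop

variable [FiniteDimensional ℝ E] [MeasurableSpace E] [BorelSpace E]

theorem neg_laplacian_eq_iff (f g : 𝓢'(E, ℂ)) :
    -Δ f = g ↔ smulLeftCLM ℂ (fun ξ : E => ((lapSymbol ξ : ℝ) : ℂ)) (𝓕 f) = 𝓕 g := by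
  have h1 : -Δ f = 𝓕⁻ (smulLeftCLM ℂ (fun ξ : E => ((lapSymbol ξ : ℝ) : ℂ)) (𝓕 f)) := by
    have h2 : (fun ξ : E => ((lapSymbol ξ : ℝ) : ℂ))
        = (((2 * Real.pi) ^ 2 : ℝ) : ℂ) • (fun ξ : E => Complex.ofReal (‖ξ‖ ^ 2)) := by
      ext ξ
      simp [lapSymbol, norm_smul, mul_pow]
    rw [laplacian_eq_fourierMultiplierCLM, h2, smulLeftCLM_smul (by fun_prop),
      fourierMultiplierCLM_apply]
    rw [smul_apply, FourierTransform.fourierInv_smul]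
    rw [neg_smul, neg_neg]
    rfl
  rw [h1]
  constructor
  · intro h
    rw [← h, fourier_fourierInv_eq]
  · intro h
    rw [h, fourierInv_fourier_eq]

theorem memLp_top_inv_one_add_lapSymbol :
    MemLp (fun ξ : E => (((1 + lapSymbol ξ)⁻¹ : ℝ) : ℂ)) ⊤ (volume : Measure E) := by
  refine memLp_top_of_bound (hasTemperateGrowth_inv_one_add_lapSymbol.1.continuous.aestronglyMeasurable)
    1 (.of_forall fun ξ => ?_)
  have := lapSymbol_nonneg ξ
  rw [Complex.norm_real, Real.norm_of_nonneg (by positivity)]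
  exact inv_le_one_of_one_le₀ (by linarith)

/-- The distributional equation `λ f̂ = ĝ`, with `λ` the symbol, involves an unbounded multiplier.
Adding `f̂` and dividing by `1 + λ` replaces it by an equation in `L²` with a bounded multiplier;
this is reversible since `1 + λ` and its inverse both have temperate growth. -/
theorem mem_negLaplacianGraph_iff (f g : L2 E) :
    (f, g) ∈ negLaplacianGraph E ↔
      (memLp_top_inv_one_add_lapSymbol (E := E)).toLp _ • (𝓕 f + 𝓕 g) = 𝓕 f := by
  have h0 : (f, g) ∈ negLaplacianGraph E ↔ -Δ (f : 𝓢'(E, ℂ)) = (g : 𝓢'(E, ℂ)) := Iff.rfl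
  have hne : ∀ ξ : E, ((1 + lapSymbol ξ : ℝ) : ℂ) ≠ 0 := fun ξ => by
    have := lapSymbol_nonneg ξ
    exact_mod_cast (by positivity : (1 + lapSymbol ξ : ℝ) ≠ 0)
  rw [h0, neg_laplacian_eq_iff, Lp.fourier_toTemperedDistribution_eq,
    Lp.fourier_toTemperedDistribution_eq]
  have hadd : ∀ u : 𝓢'(E, ℂ), smulLeftCLM ℂ (fun ξ : E => ((1 + lapSymbol ξ : ℝ) : ℂ)) u
      = u + smulLeftCLM ℂ (fun ξ : E => ((lapSymbol ξ : ℝ) : ℂ)) u := by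
    intro u
    have h1 : (fun ξ : E => ((1 + lapSymbol ξ : ℝ) : ℂ))
        = (fun _ => (1 : ℂ)) + (fun ξ : E => ((lapSymbol ξ : ℝ) : ℂ)) := by
      ext ξ; simp
    rw [h1, smulLeftCLM_add (by fun_prop) hasTemperateGrowth_lapSymbol]
    simp
  have hinv1 : ∀ u : 𝓢'(E, ℂ), smulLeftCLM ℂ (fun ξ : E => (((1 + lapSymbol ξ)⁻¹ : ℝ) : ℂ))
      (smulLeftCLM ℂ (fun ξ : E => ((1 + lapSymbol ξ : ℝ) : ℂ)) u) = u := by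
    intro u
    rw [smulLeftCLM_smulLeftCLM_apply hasTemperateGrowth_one_add_lapSymbol
      hasTemperateGrowth_inv_one_add_lapSymbol]
    convert! smulLeftCLM_const (F := ℂ) (E := E) 1 u using 2
    · congr 1; ext ξ
      have := hne ξ
      rw [Pi.mul_apply, Complex.ofReal_inv]; field_simp
    · simp
  have hinv2 : ∀ u : 𝓢'(E, ℂ), smulLeftCLM ℂ (fun ξ : E => ((1 + lapSymbol ξ : ℝ) : ℂ))
      (smulLeftCLM ℂ (fun ξ : E => (((1 + lapSymbol ξ)⁻¹ : ℝ) : ℂ)) u) = u := by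
    intro u
    rw [smulLeftCLM_smulLeftCLM_apply hasTemperateGrowth_inv_one_add_lapSymbol
      hasTemperateGrowth_one_add_lapSymbol]
    convert! smulLeftCLM_const (F := ℂ) (E := E) 1 u using 2
    · congr 1; ext ξ
      have := hne ξ
      rw [Pi.mul_apply, Complex.ofReal_inv]; field_simp
    · simp
  have hsm := Lp.toTemperedDistribution_smul_eq (r := 2) hasTemperateGrowth_inv_one_add_lapSymbol
    (memLp_top_inv_one_add_lapSymbol (E := E)) (𝓕 f + 𝓕 g : L2 E)
  have hsum : ((𝓕 f + 𝓕 g : L2 E) : 𝓢'(E, ℂ)) = ((𝓕 f : L2 E) : 𝓢'(E, ℂ)) + ((𝓕 g : L2 E) : 𝓢'(E, ℂ)) := by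
    simp only [← Lp.toTemperedDistributionCLM_apply, map_add]
  have hinj : Function.Injective (Lp.toTemperedDistributionCLM ℂ (volume : Measure E) 2) :=
    LinearMap.ker_eq_bot.mp Lp.ker_toTemperedDistributionCLM_eq_bot
  rw [hsum] at hsm
  constructor
  · intro h
    refine hinj ?_
    rw [Lp.toTemperedDistributionCLM_apply, Lp.toTemperedDistributionCLM_apply, hsm, ← h, ← hadd,
      hinv1]
  · intro h
    rw [h] at hsm
    have h2 := congrArg (smulLeftCLM ℂ (fun ξ : E => ((1 + lapSymbol ξ : ℝ) : ℂ))) hsm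
    rw [hinv2, hadd] at h2
    exact add_left_cancel h2

theorem coeFn_fourier_of_mem_negLaplacianGraph {f g : L2 E} (h : (f, g) ∈ negLaplacianGraph E) :
    (𝓕 g : L2 E) =ᵐ[volume] fun ξ => ((lapSymbol ξ : ℝ) : ℂ) * (𝓕 f : L2 E) ξ := by
  rw [mem_negLaplacianGraph_iff] at h
  have h1 := Lp.coeFn_lpSMul (r := 2) ((memLp_top_inv_one_add_lapSymbol (E := E)).toLp _)
    (𝓕 f + 𝓕 g : L2 E)
  rw [h] at h1
  filter_upwards [h1, (memLp_top_inv_one_add_lapSymbol (E := E)).coeFn_toLp,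
    Lp.coeFn_add (𝓕 f : L2 E) (𝓕 g)] with ξ h2 h3 h4
  rw [Pi.smul_apply', h3, h4, Pi.add_apply, smul_eq_mul] at h2
  have hne : ((1 + lapSymbol ξ : ℝ) : ℂ) ≠ 0 := by
    have := lapSymbol_nonneg ξ
    exact_mod_cast (by positivity : (1 + lapSymbol ξ : ℝ) ≠ 0)
  rw [Complex.ofReal_inv, inv_mul_eq_div, eq_div_iff hne] at h2
  push_cast at h2
  linear_combination -h2

theorem exists_mem_negLaplacianGraph (v : L2 E) :
    ∃ f g : L2 E, (f, g) ∈ negLaplacianGraph E ∧ f + g = v := by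
  -- The inverse Fourier transform of `u` is `(1 - Δ)⁻¹ v`.
  set u : L2 E := (memLp_top_inv_one_add_lapSymbol (E := E)).toLp _ • (𝓕 v : L2 E) with hu
  refine ⟨𝓕⁻ u, v - 𝓕⁻ u, ?_, by abel⟩
  rw [mem_negLaplacianGraph_iff, ← FourierTransform.fourier_add, add_sub_cancel, fourier_fourierInv_eq]

end Fourier

/-! ### The partial Fourier transform as an isometry -/

section FiberMap

open FourierTransform

variable {E : Type*} [NormedAddCommGroup E] [InnerProductSpace ℝ E] [FiniteDimensional ℝ E]
  [MeasurableSpace E] [BorelSpace E]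
  {H : Type*} [NormedAddCommGroup H] [InnerProductSpace ℂ H]

variable (E H) in
/-- The map `F ⊗ u ↦ û(·) F` on the algebraic tensor product. -/
noncomputable def fiberMapAlg : H ⊗[ℂ] L2 E →ₗ[ℂ] Lp H 2 (volume : Measure E) :=
  TensorProduct.lift (LinearMap.mk₂ ℂ
    (fun (F : H) (u : L2 E) => (ContinuousLinearMap.toSpanSingleton ℂ F).compLp (𝓕 u : L2 E))
    (fun F G u => by
      rw [← ContinuousLinearMap.add_compLp]
      congr 1
      ext
      simp)
    (fun c F u => by
      rw [← ContinuousLinearMap.smul_compLp]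
      congr 1
      ext
      simp)
    (fun F u v => by
      rw [FourierTransform.fourier_add]
      exact map_add ((ContinuousLinearMap.toSpanSingleton ℂ F).compLpL 2 volume) _ _)
    (fun c F u => by
      rw [FourierTransform.fourier_smul]
      exact map_smul ((ContinuousLinearMap.toSpanSingleton ℂ F).compLpL 2 volume) _ _))

theorem coeFn_fiberMapAlg_tmul (F : H) (u : L2 E) :
    fiberMapAlg E H (F ⊗ₜ u) =ᵐ[volume] fun ξ => (𝓕 u : L2 E) ξ • F := by
  filter_upwards [(ContinuousLinearMap.toSpanSingleton ℂ F).coeFn_compLp (𝓕 u : L2 E)] with ξ h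
  exact h

/-- Plancherel on pure tensors, extended by sesquilinearity. -/
theorem inner_fiberMapAlg (s t : H ⊗[ℂ] L2 E) :
    ⟪fiberMapAlg E H s, fiberMapAlg E H t⟫_ℂ = ⟪s, t⟫_ℂ := by
  induction s using TensorProduct.induction_on with
  | zero => simp
  | add x y hx hy => rw [map_add, inner_add_left, inner_add_left, hx, hy]
  | tmul F u =>
    induction t using TensorProduct.induction_on with
    | zero => simp
    | add x y hx hy => rw [map_add, inner_add_right, inner_add_right, hx, hy]
    | tmul G v =>
      rw [TensorProduct.inner_tmul, ← Lp.inner_fourier_eq u v, L2.inner_def, L2.inner_def,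
        ← integral_const_mul]
      refine integral_congr_ae ?_
      filter_upwards [coeFn_fiberMapAlg_tmul F u, coeFn_fiberMapAlg_tmul G v] with ξ h1 h2
      rw [h1, h2, inner_smul_left, inner_smul_right, RCLike.inner_apply]
      ring

variable (E H) in
/-- The map `fiberMapAlg` as an isometry. -/
noncomputable def fiberMapAlgₗᵢ : H ⊗[ℂ] L2 E →ₗᵢ[ℂ] Lp H 2 (volume : Measure E) :=
  (fiberMapAlg E H).isometryOfInner inner_fiberMapAlg

variable [CompleteSpace H]

variable (E H) in
/-- The isometry `H ⊗ L²(E) → L²(E; H)` given by the partial Fourier transform. -/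
noncomputable def fiberMap : HilbertTensor H (L2 E) →ₗᵢ[ℂ] Lp H 2 (volume : Measure E) where
  toLinearMap := ((fiberMapAlgₗᵢ E H).toContinuousLinearMap.extend
    (UniformSpace.Completion.toComplL (𝕜 := ℂ) (E := H ⊗[ℂ] L2 E))).toLinearMap
  norm_map' x := by
    induction x using UniformSpace.Completion.induction_on with
    | hp => exact isClosed_eq (by fun_prop) (by fun_prop)
    | ih t =>
      have h := ContinuousLinearMap.extend_eq (fiberMapAlgₗᵢ E H).toContinuousLinearMap
        (e := UniformSpace.Completion.toComplL (𝕜 := ℂ) (E := H ⊗[ℂ] L2 E))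
        UniformSpace.Completion.denseRange_coe
        (UniformSpace.Completion.isUniformInducing_coe _) t
      change ‖(ContinuousLinearMap.extend _ _) (UniformSpace.Completion.toComplL (𝕜 := ℂ) t)‖ = _
      rw [h, UniformSpace.Completion.norm_coe]
      exact (fiberMapAlgₗᵢ E H).norm_map t

theorem fiberMap_inclTensor (t : H ⊗[ℂ] L2 E) :
    fiberMap E H (inclTensor t) = fiberMapAlg E H t :=
  ContinuousLinearMap.extend_eq (fiberMapAlgₗᵢ E H).toContinuousLinearMap
    (e := UniformSpace.Completion.toComplL (𝕜 := ℂ) (E := H ⊗[ℂ] L2 E))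
    UniformSpace.Completion.denseRange_coe
    (UniformSpace.Completion.isUniformInducing_coe _) t

theorem coeFn_fiberMap_inclTensor_tmul (F : H) (u : L2 E) :
    fiberMap E H (inclTensor (F ⊗ₜ u)) =ᵐ[volume] fun ξ => (𝓕 u : L2 E) ξ • F := by
  rw [fiberMap_inclTensor]
  exact coeFn_fiberMapAlg_tmul F u

end FiberMap

/-! ### Decomposable operators on `L²(E; H)` -/

section Fiberwise

variable {E : Type*} [MeasureSpace E] {H : Type*} [NormedAddCommGroup H] [InnerProductSpace ℂ H]

/-- The operator on `L²(E; H)` that acts on the fiber at `ξ` by `N ξ`. -/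
noncomputable def fiberwise {N : E → H →L[ℂ] H} (hN : MemLp N ⊤ (volume : Measure E)) :
    Lp H 2 (volume : Measure E) →L[ℂ] Lp H 2 (volume : Measure E) :=
  (ContinuousLinearMap.id ℂ (H →L[ℂ] H)).holderL volume ⊤ 2 2 (hN.toLp N)

theorem coeFn_fiberwise {N : E → H →L[ℂ] H} (hN : MemLp N ⊤ (volume : Measure E))
    (f : Lp H 2 (volume : Measure E)) : fiberwise hN f =ᵐ[volume] fun ξ => N ξ (f ξ) := by
  filter_upwards [(ContinuousLinearMap.id ℂ (H →L[ℂ] H)).coeFn_holder (r := 2) (hN.toLp N) f,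
    hN.coeFn_toLp] with ξ h1 h2
  have h3 : fiberwise hN f ξ = (hN.toLp N ξ) (f ξ) := h1
  rw [h3, h2]

theorem inner_fiberwise_right {N : E → H →L[ℂ] H} (hN : MemLp N ⊤ (volume : Measure E))
    (f g : Lp H 2 (volume : Measure E)) : ⟪f, fiberwise hN g⟫_ℂ = ∫ ξ, ⟪f ξ, N ξ (g ξ)⟫_ℂ := by
  rw [L2.inner_def]
  refine integral_congr_ae ?_
  filter_upwards [coeFn_fiberwise hN g] with ξ h
  rw [h]

theorem inner_fiberwise_left {N : E → H →L[ℂ] H} (hN : MemLp N ⊤ (volume : Measure E))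
    (f g : Lp H 2 (volume : Measure E)) : ⟪fiberwise hN f, g⟫_ℂ = ∫ ξ, ⟪N ξ (f ξ), g ξ⟫_ℂ := by
  rw [L2.inner_def]
  refine integral_congr_ae ?_
  filter_upwards [coeFn_fiberwise hN f] with ξ h
  rw [h]

theorem integrable_inner_fiberwise {N : E → H →L[ℂ] H} (hN : MemLp N ⊤ (volume : Measure E))
    (f g : Lp H 2 (volume : Measure E)) : Integrable (fun ξ => ⟪f ξ, N ξ (g ξ)⟫_ℂ) := by
  refine (L2.integrable_inner f (fiberwise hN g)).congr ?_
  filter_upwards [coeFn_fiberwise hN g] with ξ h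
  rw [h]

theorem integrable_inner_fiberwise_left {N : E → H →L[ℂ] H} (hN : MemLp N ⊤ (volume : Measure E))
    (f g : Lp H 2 (volume : Measure E)) : Integrable (fun ξ => ⟪N ξ (f ξ), g ξ⟫_ℂ) := by
  refine (L2.integrable_inner (fiberwise hN f) g).congr ?_
  filter_upwards [coeFn_fiberwise hN f] with ξ h
  rw [h]

theorem integrable_norm_sq_fiberwise {N : E → H →L[ℂ] H} (hN : MemLp N ⊤ (volume : Measure E))
    (f : Lp H 2 (volume : Measure E)) : Integrable (fun ξ => ‖N ξ (f ξ)‖ ^ 2) := by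
  refine ((memLp_two_iff_integrable_sq_norm (Lp.aestronglyMeasurable _)).mp
    (Lp.memLp (fiberwise hN f))).congr ?_
  filter_upwards [coeFn_fiberwise hN f] with ξ h
  rw [h]

theorem norm_sq_fiberwise {N : E → H →L[ℂ] H} (hN : MemLp N ⊤ (volume : Measure E))
    (f : Lp H 2 (volume : Measure E)) : ‖fiberwise hN f‖ ^ 2 = ∫ ξ, ‖N ξ (f ξ)‖ ^ 2 := by
  have h1 : ⟪fiberwise hN f, fiberwise hN f⟫_ℂ = ∫ ξ, ((‖N ξ (f ξ)‖ ^ 2 : ℝ) : ℂ) := by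
    rw [L2.inner_def]
    refine integral_congr_ae ?_
    filter_upwards [coeFn_fiberwise hN f] with ξ h
    rw [h, inner_self_eq_norm_sq_to_K]
    norm_cast
  rw [inner_self_eq_norm_sq_to_K, integral_complex_ofReal] at h1
  exact Complex.ofReal_injective (by rw [← h1]; push_cast; rfl)

theorem eq_zero_of_fiberwise_eq_zero {N : E → H →L[ℂ] H} (hN : MemLp N ⊤ (volume : Measure E))
    (hinj : ∀ ξ, Function.Injective (N ξ)) {f : Lp H 2 (volume : Measure E)}
    (hf : fiberwise hN f = 0) : f = 0 := by
  rw [Lp.eq_zero_iff_ae_eq_zero]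
  have h1 := coeFn_fiberwise hN f
  rw [hf] at h1
  filter_upwards [h1, Lp.coeFn_zero H 2 (volume : Measure E)] with ξ h2 h3
  refine hinj ξ ?_
  rw [← h2, h3, Pi.zero_apply, map_zero]

/-- If the quadratic form of `N` is positive in every fiber, a vector on which the form of
`fiberwise N` vanishes is zero. -/
theorem eq_zero_of_inner_fiberwise_eq_zero {N : E → H →L[ℂ] H}
    (hN : MemLp N ⊤ (volume : Measure E)) (hpos : ∀ ξ x, x ≠ 0 → 0 < (⟪x, N ξ x⟫_ℂ).re)
    {f : Lp H 2 (volume : Measure E)} (hf : ⟪f, fiberwise hN f⟫_ℂ = 0) : f = 0 := by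
  have h0 : ∀ ξ x, 0 ≤ (⟪x, N ξ x⟫_ℂ).re := fun ξ x => by
    rcases eq_or_ne x 0 with rfl | hx
    · simp
    · exact (hpos ξ x hx).le
  have hint := integrable_inner_fiberwise hN f f
  rw [inner_fiberwise_right] at hf
  have h1 : ∫ ξ, (⟪f ξ, N ξ (f ξ)⟫_ℂ).re = 0 := by
    have := integral_re hint
    rw [hf] at this
    simpa using this
  have h2 := (integral_eq_zero_iff_of_nonneg (fun ξ => h0 ξ (f ξ)) hint.re).mp h1
  rw [Lp.eq_zero_iff_ae_eq_zero]
  filter_upwards [h2] with ξ h3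
  by_contra hne
  exact (hpos ξ (f ξ) hne).ne' h3

end Fiberwise

/-! ### Density of the range of the tensor sum -/

section RangeFiber

variable {E : Type*} [NormedAddCommGroup E] [InnerProductSpace ℝ E]
  {H : Type*} [NormedAddCommGroup H] [InnerProductSpace ℂ H]

variable (E) in
/-- The fibers of the bounded operator that maps `u ⊗ v` to `(A ⊗ I + I ⊗ (-Δ)) (A⁻¹ u ⊗ (1 - Δ)⁻¹ v)`. -/
noncomputable def rangeFiber (A : H →ₗ.[ℂ] H) (ξ : E) : H →L[ℂ] H :=
  (((1 + lapSymbol ξ)⁻¹ : ℝ) : ℂ) • 1 + ((lapSymbol ξ * (1 + lapSymbol ξ)⁻¹ : ℝ) : ℂ) • invOp A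

/-- The summand `(1 + λ)⁻¹` makes the form strictly positive. No bound uniform in `ξ` holds in
general, nor is one needed: strict positivity in each fiber already excludes a nonzero vector
orthogonal to the range. -/
theorem inner_rangeFiber_pos [CompleteSpace H] {A : H →ₗ.[ℂ] H} {ℓ : ℝ}
    (hA : IsSelfAdjoint A) (hℓ : 0 < ℓ) (hb : BoundedBelow A ℓ) (ξ : E)
    {x : H} (hx : x ≠ 0) : 0 < (⟪x, rangeFiber E A ξ x⟫_ℂ).re := by
  have h0 := lapSymbol_nonneg ξ
  have h1 : 0 ≤ (⟪x, invOp A x⟫_ℂ).re :=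
    ((ContinuousLinearMap.nonneg_iff_isPositive _).mp (invOp_nonneg hA hℓ hb)).re_inner_nonneg_right x
  have h2 : 0 < ‖x‖ := norm_pos_iff.mpr hx
  have h3 : (⟪x, rangeFiber E A ξ x⟫_ℂ).re = (1 + lapSymbol ξ)⁻¹ * ‖x‖ ^ 2
      + (lapSymbol ξ * (1 + lapSymbol ξ)⁻¹) * (⟪x, invOp A x⟫_ℂ).re := by
    rw [rangeFiber, add_apply, smul_apply, smul_apply, one_apply_eq_self, inner_add_right,
      inner_smul_right, inner_smul_right, Complex.add_re, Complex.re_ofReal_mul,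
      Complex.re_ofReal_mul, inner_self_eq_norm_sq_to_K]
    norm_cast
  rw [h3]
  positivity

end RangeFiber

theorem tensorSumGraph_generator_tmul {H K : Type*} [NormedAddCommGroup H] [InnerProductSpace ℂ H]
    [NormedAddCommGroup K] [InnerProductSpace ℂ K] (A : H →ₗ.[ℂ] H) (B : K →ₗ.[ℂ] K)
    (x : A.domain) (y : B.domain) :
    ((inclTensor ∘ₗ TensorProduct.map A.domain.subtype B.domain.subtype).prod
      (inclTensor ∘ₗ (TensorProduct.map A.toFun B.domain.subtype +
        TensorProduct.map A.domain.subtype B.toFun))) (x ⊗ₜ y)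
      = (inclTensor ((x : H) ⊗ₜ (y : K)),
        inclTensor (A x ⊗ₜ (y : K)) + inclTensor ((x : H) ⊗ₜ B y)) := by
  rw [← map_add]
  rfl

section TensorSum

open FourierTransform

variable {E : Type*} [NormedAddCommGroup E] [InnerProductSpace ℝ E] [FiniteDimensional ℝ E]
  [MeasurableSpace E] [BorelSpace E]
  {H : Type*} [NormedAddCommGroup H] [InnerProductSpace ℂ H] [CompleteSpace H]
  {A : H →ₗ.[ℂ] H} {ℓ : ℝ}

variable (E) in
theorem memLp_top_negPow_shiftOp (hA : IsSelfAdjoint A) (hℓ : 0 < ℓ) (hb : BoundedBelow A ℓ)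
    {s : ℝ} (hs : 0 ≤ s) :
    MemLp (fun ξ : E => negPow (shiftOp A (lapSymbol ξ)) s) ⊤ (volume : Measure E) := by
  refine memLp_top_of_bound (aestronglyMeasurable_negPow_shiftOp_comp hA hℓ hb
    continuous_lapSymbol lapSymbol_nonneg hs) (ℓ ^ (-s)) (.of_forall fun ξ => ?_)
  refine (norm_negPow_shiftOp_le hA hℓ hb (lapSymbol_nonneg ξ) hs).trans ?_
  exact Real.rpow_le_rpow_of_nonpos hℓ (by linarith [lapSymbol_nonneg ξ]) (by linarith)

variable (E) in
theorem memLp_top_invOp_shiftOp (hA : IsSelfAdjoint A) (hℓ : 0 < ℓ) (hb : BoundedBelow A ℓ) :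
    MemLp (fun ξ : E => invOp (shiftOp A (lapSymbol ξ))) ⊤ (volume : Measure E) := by
  have h := memLp_top_negPow_shiftOp E hA hℓ hb zero_le_one
  simp_rw [negPow, fun ξ : E => CFC.rpow_one _
    (invOp_shiftOp_nonneg hA hℓ hb (lapSymbol_nonneg ξ))] at h
  exact h

theorem invOp_shiftOp_injective (hA : IsSelfAdjoint A) (hℓ : 0 < ℓ) (hb : BoundedBelow A ℓ)
    {c : ℝ} (hc : 0 ≤ c) : Function.Injective (invOp (shiftOp A c)) := by
  rw [injective_iff_map_eq_zero]
  intro y hy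
  obtain ⟨h1, h2⟩ := (isBoundedInverse_invOp_shiftOp hA hℓ hb hc).2 y
  rw [← h2, show (⟨invOp (shiftOp A c) y, h1⟩ : (shiftOp A c).domain) = 0 from Subtype.ext hy,
    LinearPMap.map_zero]

theorem mem_negLaplacianGraph_apply (y : (negLaplacian E).domain) :
    ((y : L2 E), negLaplacian E y) ∈ negLaplacianGraph E := by
  rw [← negLaplacianGraph_eq_graph]
  exact (negLaplacian E).mem_graph y

/-- In the fibers, `A ⊗ I + I ⊗ (-Δ)` is the operator `A + |2πξ|²`. -/
theorem fiberMap_fst_of_mem_tensorSumGraph (hA : IsSelfAdjoint A) (hℓ : 0 < ℓ)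
    (hb : BoundedBelow A ℓ) {p : HilbertTensor H (L2 E) × HilbertTensor H (L2 E)}
    (hp : p ∈ tensorSumGraph A (negLaplacian E)) :
    fiberMap E H p.1 = fiberwise (memLp_top_invOp_shiftOp E hA hℓ hb) (fiberMap E H p.2) := by
  obtain ⟨t, rfl⟩ := hp
  induction t using TensorProduct.induction_on with
  | zero => rw [map_zero, Prod.fst_zero, Prod.snd_zero, map_zero, map_zero]
  | add s t hs ht => rw [map_add, Prod.fst_add, Prod.snd_add, map_add, map_add, map_add, hs, ht]
  | tmul x y =>
    rw [tensorSumGraph_generator_tmul, map_add, map_add]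
    refine Lp.ext ?_
    filter_upwards [coeFn_fiberMap_inclTensor_tmul (x : H) (y : L2 E),
      coeFn_fiberMap_inclTensor_tmul (A x) (y : L2 E),
      coeFn_fiberMap_inclTensor_tmul (x : H) (negLaplacian E y),
      coeFn_fourier_of_mem_negLaplacianGraph (mem_negLaplacianGraph_apply y),
      coeFn_fiberwise (memLp_top_invOp_shiftOp E hA hℓ hb)
        (fiberMap E H (inclTensor (A x ⊗ₜ (y : L2 E)))),
      coeFn_fiberwise (memLp_top_invOp_shiftOp E hA hℓ hb)
        (fiberMap E H (inclTensor ((x : H) ⊗ₜ negLaplacian E y))),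
      Lp.coeFn_add (fiberwise (memLp_top_invOp_shiftOp E hA hℓ hb)
        (fiberMap E H (inclTensor (A x ⊗ₜ (y : L2 E)))))
        (fiberwise (memLp_top_invOp_shiftOp E hA hℓ hb)
        (fiberMap E H (inclTensor ((x : H) ⊗ₜ negLaplacian E y))))]
      with ξ h1 h2 h3 h4 h5 h6 h7
    have h8 := (isBoundedInverse_invOp_shiftOp hA hℓ hb (lapSymbol_nonneg ξ)).1 ⟨x, x.2⟩
    rw [shiftOp_apply] at h8
    change _ = (fiberwise (memLp_top_invOp_shiftOp E hA hℓ hb)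
        (fiberMap E H (inclTensor (A x ⊗ₜ (y : L2 E)))) + (fiberwise (memLp_top_invOp_shiftOp E hA hℓ hb)
        (fiberMap E H (inclTensor ((x : H) ⊗ₜ negLaplacian E y)))) : Lp H 2 (volume : Measure E)) ξ
    rw [h7, Pi.add_apply, h5, h6, h1, h2, h3, h4, ← map_add]
    have h9 : (𝓕 (y : L2 E) : L2 E) ξ • A x + ((lapSymbol ξ : ℂ) * (𝓕 (y : L2 E) : L2 E) ξ) • (x : H)
        = (𝓕 (y : L2 E) : L2 E) ξ • ((lapSymbol ξ : ℂ) • (x : H) + A x) := by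
      rw [smul_add, smul_smul, mul_comm, add_comm]
    rw [h9, map_smul, h8]

variable (E A) in
theorem memLp_top_rangeFiber : MemLp (rangeFiber E A) ⊤ (volume : Measure E) := by
  have hc : Continuous fun ξ : E => (1 + lapSymbol ξ)⁻¹ :=
    (by fun_prop : Continuous fun ξ : E => 1 + lapSymbol ξ).inv₀ fun ξ => by
      have := lapSymbol_nonneg ξ
      positivity
  refine memLp_top_of_bound (C := 1 * ‖(1 : H →L[ℂ] H)‖ + 1 * ‖invOp A‖) ?_ (.of_forall fun ξ => ?_)
  · exact Continuous.aestronglyMeasurable (by unfold rangeFiber; fun_prop)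
  · have := lapSymbol_nonneg ξ
    refine (norm_add_le _ _).trans ?_
    rw [norm_smul, norm_smul, Complex.norm_real, Complex.norm_real,
      Real.norm_of_nonneg (by positivity), Real.norm_of_nonneg (by positivity)]
    gcongr
    · exact inv_le_one_of_one_le₀ (by linarith)
    · rw [← div_eq_mul_inv, div_le_one (by positivity)]
      linarith

theorem exists_mem_tensorSumGraph_snd (hA : IsSelfAdjoint A) (hℓ : 0 < ℓ) (hb : BoundedBelow A ℓ)
    (u : H) (v : L2 E) : ∃ p ∈ tensorSumGraph A (negLaplacian E),
      fiberMap E H p.2 = fiberwise (memLp_top_rangeFiber E A) (fiberMap E H (inclTensor (u ⊗ₜ v))) := by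
  obtain ⟨f, g, hfg, hv⟩ := exists_mem_negLaplacianGraph v
  obtain ⟨hu, hu'⟩ := (isBoundedInverse_invOp hA hℓ hb).2 u
  have hmem := hfg
  rw [← negLaplacianGraph_eq_graph, LinearPMap.mem_graph_iff] at hmem
  obtain ⟨y, hy1, hy2⟩ := hmem
  simp only at hy1 hy2
  -- The preimage is `A⁻¹ u ⊗ f` with `f = (1 - Δ)⁻¹ v`; its image is `u ⊗ f + A⁻¹ u ⊗ g`, where `f̂
  -- = v̂ / (1 + λ)` and `ĝ = λ v̂ / (1 + λ)`.
  refine ⟨_, ⟨⟨invOp A u, hu⟩ ⊗ₜ y, rfl⟩, ?_⟩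
  rw [tensorSumGraph_generator_tmul]
  simp only [map_add, hu', hy1, hy2]
  refine Lp.ext ?_
  filter_upwards [coeFn_fiberMap_inclTensor_tmul u f, coeFn_fiberMap_inclTensor_tmul (invOp A u) g,
    coeFn_fiberMap_inclTensor_tmul u v,
    coeFn_fourier_of_mem_negLaplacianGraph hfg, Lp.coeFn_add (𝓕 f : L2 E) (𝓕 g),
    coeFn_fiberwise (memLp_top_rangeFiber E A) (fiberMap E H (inclTensor (u ⊗ₜ v))),
    Lp.coeFn_add (fiberMap E H (inclTensor (u ⊗ₜ f)))
      (fiberMap E H (inclTensor (invOp A u ⊗ₜ g)))] with ξ h1 h2 h3 h4 h5 h6 h7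
  rw [← FourierTransform.fourier_add, hv, Pi.add_apply, h4] at h5
  rw [h7, h6, Pi.add_apply, h1, h2, h3, h4, h5]
  have h0 := lapSymbol_nonneg ξ
  have hne : (1 + (lapSymbol ξ : ℂ)) ≠ 0 := by
    exact_mod_cast (by positivity : (1 + lapSymbol ξ : ℝ) ≠ 0)
  rw [rangeFiber, add_apply, smul_apply, smul_apply, one_apply_eq_self, map_smul, smul_smul,
    smul_smul]
  push_cast
  congr 2 <;> field_simp

variable (E) in
theorem dense_map_snd_tensorSumGraph (hA : IsSelfAdjoint A) (hℓ : 0 < ℓ) (hb : BoundedBelow A ℓ) :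
    Dense ((tensorSumGraph A (negLaplacian E)).map (LinearMap.snd ℂ _ _) :
      Set (HilbertTensor H (L2 E))) := by
  rw [Submodule.dense_iff_topologicalClosure_eq_top, Submodule.topologicalClosure_eq_top_iff,
    Submodule.eq_bot_iff]
  intro f hf
  rw [Submodule.mem_orthogonal'] at hf
  have h1 : ∀ t : H ⊗[ℂ] L2 E, ⟪fiberMap E H f, fiberwise (memLp_top_rangeFiber E A)
      (fiberMap E H (inclTensor t))⟫_ℂ = 0 := by
    intro t
    induction t using TensorProduct.induction_on with
    | zero => simp
    | add s t hs ht => rw [map_add, map_add, map_add, inner_add_right, hs, ht, add_zero]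
    | tmul u v =>
      obtain ⟨p, hp, hp2⟩ := exists_mem_tensorSumGraph_snd hA hℓ hb u v
      rw [← hp2, LinearIsometry.inner_map_map]
      exact hf _ ⟨p, hp, rfl⟩
  -- Orthogonality against all algebraic tensors extends to the completion, so the test vector may
  -- be `f` itself.
  have h2 : ⟪fiberMap E H f, fiberwise (memLp_top_rangeFiber E A) (fiberMap E H f)⟫_ℂ = 0 := by
    refine UniformSpace.Completion.induction_on
      (p := fun g : HilbertTensor H (L2 E) => ⟪fiberMap E H f,
        fiberwise (memLp_top_rangeFiber E A) (fiberMap E H g)⟫_ℂ = 0) f ?_ h1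
    exact isClosed_eq (by fun_prop) continuous_const
  have h3 := eq_zero_of_inner_fiberwise_eq_zero (memLp_top_rangeFiber E A)
    (fun ξ x hx => inner_rangeFiber_pos hA hℓ hb ξ hx) h2
  exact (fiberMap E H).injective (h3.trans (map_zero _).symm)

end TensorSum

/-! ### Self-adjointness and lower bound of the tensor sum -/

section SelfAdjoint

variable {E : Type*} [NormedAddCommGroup E] [InnerProductSpace ℝ E] [FiniteDimensional ℝ E]
  [MeasurableSpace E] [BorelSpace E]
  {H : Type*} [NormedAddCommGroup H] [InnerProductSpace ℂ H] [CompleteSpace H]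
  {A : H →ₗ.[ℂ] H} {ℓ : ℝ}

/-- Phrased with the bounded fiberwise inverse, the relation is a closed condition on pairs, so it
survives the closure. -/
theorem fiberMap_fst_of_mem_closure (hA : IsSelfAdjoint A) (hℓ : 0 < ℓ)
    (hb : BoundedBelow A ℓ) {p : HilbertTensor H (L2 E) × HilbertTensor H (L2 E)}
    (hp : p ∈ (tensorSumGraph A (negLaplacian E)).topologicalClosure) :
    fiberMap E H p.1 = fiberwise (memLp_top_invOp_shiftOp E hA hℓ hb) (fiberMap E H p.2) := by
  have hcl : IsClosed {p : HilbertTensor H (L2 E) × HilbertTensor H (L2 E) |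
      fiberMap E H p.1 = fiberwise (memLp_top_invOp_shiftOp E hA hℓ hb) (fiberMap E H p.2)} :=
    isClosed_eq (by fun_prop) (by fun_prop)
  exact closure_minimal
    (fun q hq => fiberMap_fst_of_mem_tensorSumGraph hA hℓ hb hq) hcl hp

variable (E) in
theorem graph_tensorSum (hA : IsSelfAdjoint A) (hℓ : 0 < ℓ) (hb : BoundedBelow A ℓ) :
    (tensorSum A (negLaplacian E)).graph
      = (tensorSumGraph A (negLaplacian E)).topologicalClosure := by
  have hg : (tensorSumGraph A (negLaplacian E)).topologicalClosure.toLinearPMap.graph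
      = (tensorSumGraph A (negLaplacian E)).topologicalClosure := by
    refine Submodule.toLinearPMap_graph_eq _ ?_
    rintro ⟨f, g⟩ h (rfl : f = 0)
    have h1 := fiberMap_fst_of_mem_closure hA hℓ hb h
    simp only [map_zero] at h1
    -- Closability: a limit pair `(0, g)` has its fibers annihilated by the injective operators `(A
    -- + λ)⁻¹`.
    have h2 := eq_zero_of_fiberwise_eq_zero _
      (fun ξ => invOp_shiftOp_injective hA hℓ hb (lapSymbol_nonneg ξ)) h1.symm
    exact (fiberMap E H).injective (h2.trans (map_zero _).symm)
  have hcl : (tensorSumGraph A (negLaplacian E)).toLinearPMap.IsClosable :=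
    ⟨(tensorSumGraph A (negLaplacian E)).topologicalClosure.toLinearPMap, by
      rw [hg, tensorSumGraph_eq_graph]⟩
  rw [tensorSum, ← hcl.graph_closure_eq_closure_graph, tensorSumGraph_eq_graph]

theorem fiberMap_eq_fiberwise_of_mem_graph (hA : IsSelfAdjoint A) (hℓ : 0 < ℓ)
    (hb : BoundedBelow A ℓ) (x : (tensorSum A (negLaplacian E)).domain) :
    fiberMap E H x = fiberwise (memLp_top_invOp_shiftOp E hA hℓ hb)
      (fiberMap E H (tensorSum A (negLaplacian E) x)) := by
  refine fiberMap_fst_of_mem_closure hA hℓ hb (p := (↑x, tensorSum A (negLaplacian E) x)) ?_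
  rw [← graph_tensorSum E hA hℓ hb]
  exact (tensorSum A (negLaplacian E)).mem_graph x

theorem tensorSum_surjective (hA : IsSelfAdjoint A) (hℓ : 0 < ℓ) (hb : BoundedBelow A ℓ)
    (y : HilbertTensor H (L2 E)) : ∃ x, tensorSum A (negLaplacian E) x = y := by
  obtain ⟨u, hu, huy⟩ := mem_closure_iff_seq_limit.mp
    (dense_map_snd_tensorSumGraph E hA hℓ hb y)
  choose p hp hpu using hu
  have hpu' : ∀ n, (p n).2 = u n := hpu
  set M := fiberwise (memLp_top_invOp_shiftOp E hA hℓ hb)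
  have h1 : Tendsto (fun n => fiberMap E H (p n).1) atTop (𝓝 (M (fiberMap E H y))) := by
    simp_rw [fun n => fiberMap_fst_of_mem_tensorSumGraph hA hℓ hb (hp n), hpu']
    exact ((M.continuous.comp (fiberMap E H).continuous).tendsto y).comp huy
  -- The image of an isometry from a complete space is closed, so the limit has a preimage and
  -- surjectivity of `fiberMap` is not needed.
  obtain ⟨x, hx⟩ := (fiberMap E H).isometry.isClosedEmbedding.isClosed_range.mem_of_tendsto h1
    (Eventually.of_forall fun n => ⟨_, rfl⟩)
  rw [← hx] at h1
  have h2 : Tendsto (fun n => (p n).1) atTop (𝓝 x) :=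
    (fiberMap E H).isometry.isEmbedding.tendsto_nhds_iff.mpr h1
  have h3 : (x, y) ∈ (tensorSum A (negLaplacian E)).graph := by
    rw [graph_tensorSum E hA hℓ hb]
    refine mem_closure_of_tendsto (h2.prodMk_nhds huy) (Eventually.of_forall fun n => ?_)
    rw [← hpu' n]
    exact hp n
  obtain ⟨w, -, hw⟩ := (LinearPMap.mem_graph_iff _).mp h3
  exact ⟨w, hw⟩

theorem tensorSum_isFormalAdjoint (hA : IsSelfAdjoint A) (hℓ : 0 < ℓ) (hb : BoundedBelow A ℓ) :
    (tensorSum A (negLaplacian E)).IsFormalAdjoint (tensorSum A (negLaplacian E)) := by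
  intro x y
  rw [← (fiberMap E H).inner_map_map, ← (fiberMap E H).inner_map_map,
    fiberMap_eq_fiberwise_of_mem_graph hA hℓ hb x, fiberMap_eq_fiberwise_of_mem_graph hA hℓ hb y,
    inner_fiberwise_right, inner_fiberwise_left]
  refine integral_congr_ae (.of_forall fun ξ => ?_)
  exact (((ContinuousLinearMap.nonneg_iff_isPositive _).mp
    (invOp_shiftOp_nonneg hA hℓ hb (lapSymbol_nonneg ξ))).1 _ _).symm

theorem boundedBelow_tensorSum (hA : IsSelfAdjoint A) (hℓ : 0 < ℓ) (hb : BoundedBelow A ℓ) :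
    BoundedBelow (tensorSum A (negLaplacian E)) ℓ := by
  intro x
  set hN := memLp_top_invOp_shiftOp E hA hℓ hb
  set g := fiberMap E H (tensorSum A (negLaplacian E) x)
  have h1 : (⟪(x : HilbertTensor H (L2 E)), tensorSum A (negLaplacian E) x⟫_ℂ).re
      = ∫ ξ, (⟪invOp (shiftOp A (lapSymbol ξ)) (g ξ), g ξ⟫_ℂ).re := by
    rw [← (fiberMap E H).inner_map_map, fiberMap_eq_fiberwise_of_mem_graph hA hℓ hb x,
      inner_fiberwise_left]
    exact (integral_re (integrable_inner_fiberwise_left hN g g)).symm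
  have h2 : ‖(x : HilbertTensor H (L2 E))‖ ^ 2
      = ∫ ξ, ‖invOp (shiftOp A (lapSymbol ξ)) (g ξ)‖ ^ 2 := by
    rw [← (fiberMap E H).norm_map, fiberMap_eq_fiberwise_of_mem_graph hA hℓ hb x,
      norm_sq_fiberwise]
  rw [h1, h2, ← integral_const_mul]
  refine integral_mono_ae ?_ ?_ (.of_forall fun ξ => ?_)
  · exact (integrable_norm_sq_fiberwise hN g).const_mul ℓ
  · exact (integrable_inner_fiberwise_left hN g g).re
  · have h3 := (isBoundedInverse_invOp_shiftOp hA hℓ hb (lapSymbol_nonneg ξ)).sq_norm_le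
      (hb.shift (lapSymbol ξ)) (g ξ)
    refine le_trans (mul_le_mul_of_nonneg_right ?_ (sq_nonneg _)) h3
    linarith [lapSymbol_nonneg ξ]

variable (E) in
theorem isSelfAdjoint_tensorSum (hA : IsSelfAdjoint A) (hℓ : 0 < ℓ) (hb : BoundedBelow A ℓ) :
    IsSelfAdjoint (tensorSum A (negLaplacian E)) :=
  isSelfAdjoint_of_surjective hℓ (boundedBelow_tensorSum hA hℓ hb)
    (tensorSum_isFormalAdjoint hA hℓ hb) (tensorSum_surjective hA hℓ hb)

end SelfAdjoint

/-! ### Functional calculus in the fibers -/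

section FiberCalculus

-- Uniform approximation on an interval containing the spectrum gives norm convergence. The
-- polynomials depend only on `φ` and the interval, so one sequence serves the global operator and
-- all fibers at once.
open Polynomial in
theorem tendsto_aeval_apply_cfc {L : Type*} [NormedAddCommGroup L] [InnerProductSpace ℂ L]
    [CompleteSpace L] {a b : ℝ} {φ : ℝ → ℝ} (hφ : ContinuousOn φ (Set.Icc a b)) {q : ℕ → ℝ[X]}
    (hq : ∀ n : ℕ, ∀ x ∈ Set.Icc a b, |(q n).eval x - φ x| < 1 / (n + 1 : ℝ))
    {S : L →L[ℂ] L} (hS : IsSelfAdjoint S) (hSs : spectrum ℝ S ⊆ Set.Icc a b) (x : L) :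
    Tendsto (fun n => aeval S (q n) x) atTop (𝓝 (cfc φ S x)) := by
  have h1 : Tendsto (fun n => aeval S (q n)) atTop (𝓝 (cfc φ S)) := by
    refine tendsto_iff_norm_sub_tendsto_zero.mpr (squeeze_zero (fun _ => norm_nonneg _)
      (fun n => ?_) (tendsto_one_div_add_atTop_nhds_zero_nat (𝕜 := ℝ)))
    rw [← cfc_polynomial (R := ℝ) (q n) S hS, ← cfc_sub _ _ S (by fun_prop) (hφ.mono hSs)]
    exact norm_cfc_le (by positivity) fun x hx => (hq n x (hSs hx)).le
  exact ((ContinuousLinearMap.apply ℂ L x).continuous.tendsto _).comp h1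

variable {E : Type*} [MeasureSpace E]
  {H : Type*} [NormedAddCommGroup H] [InnerProductSpace ℂ H]
  {K : Type*} [NormedAddCommGroup K] [InnerProductSpace ℂ K]
  {V : K →ₗᵢ[ℂ] Lp H 2 (volume : Measure E)}

open Polynomial in
theorem coeFn_isometry_aeval {T : K →L[ℂ] K}
    {N : E → H →L[ℂ] H}
    (h : ∀ f, V (T f) =ᵐ[volume] fun ξ => N ξ (V f ξ)) (q : ℝ[X])
    (f : K) :
    V (aeval T q f) =ᵐ[volume] fun ξ => aeval (N ξ) q (V f ξ) := by
  induction q using Polynomial.induction_on generalizing f with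
  | C a =>
    simp only [aeval_C]
    have h1 : V ((algebraMap ℝ (K →L[ℂ] K) a) f)
        = (a : ℂ) • V f := by
      rw [← map_smul]; rfl
    rw [h1]
    filter_upwards [Lp.coeFn_smul (a : ℂ) (V f)] with ξ h2
    rw [h2]
    rfl
  | add p q hp hq =>
    simp only [map_add, add_apply]
    filter_upwards [hp f, hq f, Lp.coeFn_add (V (aeval T p f))
      (V (aeval T q f))] with ξ h1 h2 h3
    rw [h3, Pi.add_apply, h1, h2]
  | monomial n a hn =>
    simp only [pow_succ, ← mul_assoc]
    simp only [map_mul _ _ (X : ℝ[X]), aeval_X, mul_apply_eq_comp]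
    filter_upwards [hn (T f), h f] with ξ h1 h2
    rw [h1, h2]

/-- A decomposition into fibers passes to continuous functions. -/
theorem coeFn_isometry_cfc [CompleteSpace H] [CompleteSpace K] {T : K →L[ℂ] K} {N : E → H →L[ℂ] H}
    (h : ∀ f, V (T f) =ᵐ[volume] fun ξ => N ξ (V f ξ)) {a b : ℝ}
    (hT : IsSelfAdjoint T) (hTs : spectrum ℝ T ⊆ Set.Icc a b) (hN : ∀ ξ, IsSelfAdjoint (N ξ))
    (hNs : ∀ ξ, spectrum ℝ (N ξ) ⊆ Set.Icc a b) {φ : ℝ → ℝ} (hφ : ContinuousOn φ (Set.Icc a b))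
    (f : K) : V (cfc φ T f) =ᵐ[volume] fun ξ => cfc φ (N ξ) (V f ξ) := by
  choose q hq using fun n : ℕ => exists_polynomial_near_of_continuousOn a b φ hφ (1 / (n + 1 : ℝ))
    (by positivity)
  have h1 : Tendsto (fun n => V (Polynomial.aeval T (q n) f)) atTop (𝓝 (V (cfc φ T f))) :=
    (V.continuous.tendsto _).comp (tendsto_aeval_apply_cfc hφ hq hT hTs f)
  -- Convergence in `L²` gives almost everywhere convergence only along a subsequence; in the fibers
  -- the whole sequence converges, so the two limits can be compared.
  obtain ⟨ns, hns, hae⟩ := (tendstoInMeasure_of_tendsto_Lp h1).exists_seq_tendsto_ae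
  filter_upwards [hae, ae_all_iff.mpr fun n => coeFn_isometry_aeval h (q n) f] with ξ h2 h3
  refine tendsto_nhds_unique h2 ?_
  simp_rw [h3]
  exact (tendsto_aeval_apply_cfc hφ hq (hN ξ) (hNs ξ) _).comp hns.tendsto_atTop

end FiberCalculus

section FunctionalCalculus

variable {E : Type*} [NormedAddCommGroup E] [InnerProductSpace ℝ E] [FiniteDimensional ℝ E]
  [MeasurableSpace E] [BorelSpace E]
  {H : Type*} [NormedAddCommGroup H] [InnerProductSpace ℂ H] [CompleteSpace H]
  {A : H →ₗ.[ℂ] H} {ℓ : ℝ}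

theorem coeFn_fiberMap_invOp_tensorSum (hA : IsSelfAdjoint A) (hℓ : 0 < ℓ) (hb : BoundedBelow A ℓ)
    (f : HilbertTensor H (L2 E)) :
    fiberMap E H (invOp (tensorSum A (negLaplacian E)) f)
      =ᵐ[volume] fun ξ => invOp (shiftOp A (lapSymbol ξ)) (fiberMap E H f ξ) := by
  obtain ⟨h1, h2⟩ := (isBoundedInverse_invOp (isSelfAdjoint_tensorSum E hA hℓ hb) hℓ
    (boundedBelow_tensorSum hA hℓ hb)).2 f
  have h3 := fiberMap_eq_fiberwise_of_mem_graph hA hℓ hb ⟨_, h1⟩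
  rw [h2] at h3
  simp only at h3
  rw [h3]
  exact coeFn_fiberwise _ _

theorem coeFn_fiberMap_negPow_tensorSum (hA : IsSelfAdjoint A) (hℓ : 0 < ℓ)
    (hb : BoundedBelow A ℓ) {s : ℝ} (hs : 0 ≤ s) (f : HilbertTensor H (L2 E)) :
    fiberMap E H (negPow (tensorSum A (negLaplacian E)) s f)
      =ᵐ[volume] fun ξ => negPow (shiftOp A (lapSymbol ξ)) s (fiberMap E H f ξ) := by
  have hA' := isSelfAdjoint_tensorSum E hA hℓ hb
  have hb' := boundedBelow_tensorSum (E := E) hA hℓ hb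
  rw [negPow_eq_cfc hA' hℓ hb']
  simp_rw [negPow, fun ξ : E => CFC.rpow_eq_cfc_real (y := s)
    (invOp_shiftOp_nonneg hA hℓ hb (lapSymbol_nonneg ξ))]
  exact coeFn_isometry_cfc (coeFn_fiberMap_invOp_tensorSum hA hℓ hb)
    (.of_nonneg (invOp_nonneg hA' hℓ hb')) (spectrum_invOp_subset hA' hℓ hb')
    (fun ξ => .of_nonneg (invOp_shiftOp_nonneg hA hℓ hb (lapSymbol_nonneg ξ)))
    (fun ξ => spectrum_invOp_shiftOp_subset hA hℓ hb (lapSymbol_nonneg ξ))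
    (Real.continuous_rpow_const hs).continuousOn f

end FunctionalCalculus

/-! ### Fourier transforms of mollifiers -/

section Mollifier

open FourierTransform

variable {E : Type*} [NormedAddCommGroup E] [InnerProductSpace ℝ E] [FiniteDimensional ℝ E]
  [MeasurableSpace E] [BorelSpace E] {ρ : E → ℂ}

theorem IsMollifier.rescale_contDiff (hρ : IsMollifier ρ) (δ : ℝ) : ContDiff ℝ ∞ (rescale ρ δ) := by
  have := hρ.contDiff
  unfold rescale
  fun_prop

theorem IsMollifier.rescale_hasCompactSupport (hρ : IsMollifier ρ) {δ : ℝ} (hδ : 0 < δ) :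
    HasCompactSupport (rescale ρ δ) :=
  (hρ.hasCompactSupport.comp_smul (inv_ne_zero hδ.ne')).mul_left

theorem fourier_rescale (ρ : E → ℂ) {δ : ℝ} (hδ : 0 < δ) (ξ : E) :
    𝓕 (rescale ρ δ) ξ = 𝓕 ρ (δ • ξ) := by
  rw [Real.fourier_eq, Real.fourier_eq]
  have h1 : ∀ z : E, Real.fourierChar (-⟪z, ξ⟫_ℝ) • rescale ρ δ z = ((δ : ℂ) ^ Module.finrank ℝ E)⁻¹ *
      (fun y : E => Real.fourierChar (-⟪y, δ • ξ⟫_ℝ) • ρ y) (δ⁻¹ • z) := by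
    intro z
    have h2 : ⟪δ⁻¹ • z, δ • ξ⟫_ℝ = ⟪z, ξ⟫_ℝ := by
      rw [real_inner_smul_left, real_inner_smul_right]
      field_simp
    simp only [h2, rescale, Circle.smul_def, smul_eq_mul]
    ring
  simp_rw [h1]
  rw [integral_const_mul, Measure.integral_comp_inv_smul_of_nonneg volume
    (fun y : E => Real.fourierChar (-⟪y, δ • ξ⟫_ℝ) • ρ y) hδ.le, Complex.real_smul, ← mul_assoc]
  push_cast
  rw [inv_mul_cancel₀ (pow_ne_zero _ (Complex.ofReal_ne_zero.mpr hδ.ne')), one_mul]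

/-- The `L²` transform agrees with the integral transform because `ρ_δ`, smooth with compact
support, is a Schwartz function. -/
theorem coeFn_fourier_rescaleL2 (hρ : IsMollifier ρ) {δ : ℝ} (hδ : 0 < δ) :
    (𝓕 (rescaleL2 ρ δ) : L2 E) =ᵐ[volume] fun ξ => 𝓕 ρ (δ • ξ) := by
  set S : 𝓢(E, ℂ) :=
    (hρ.rescale_hasCompactSupport hδ).toSchwartzMap (hρ.rescale_contDiff δ)
  have hS : (S : E → ℂ) = rescale ρ δ := rfl
  have h1 : rescaleL2 ρ δ = S.toLp 2 := by
    rw [rescaleL2, dif_pos (memLp_rescale hρ.contDiff.continuous hρ.hasCompactSupport hδ)]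
    rfl
  rw [h1, SchwartzMap.toLp_fourier_eq]
  filter_upwards [(𝓕 S).coeFn_toLp 2 volume] with ξ h2
  rw [h2, SchwartzMap.fourier_coe, hS, fourier_rescale ρ hδ]

theorem IsMollifier.fourier_zero (hρ : IsMollifier ρ) : 𝓕 ρ 0 = 1 := by
  rw [Real.fourier_eq, ← hρ.integral_eq_one]
  simp

theorem IsMollifier.continuous_fourier (hρ : IsMollifier ρ) : Continuous (𝓕 ρ) :=
  (𝓕 (hρ.hasCompactSupport.toSchwartzMap hρ.contDiff)).continuous

theorem IsMollifier.norm_fourier_le (hρ : IsMollifier ρ) :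
    ∃ C, ∀ ξ, ‖𝓕 ρ ξ‖ ≤ C :=
  ⟨_, fun ξ => (𝓕 (hρ.hasCompactSupport.toSchwartzMap hρ.contDiff)).toBoundedContinuousFunction.norm_coe_le_norm ξ⟩

end Mollifier

/-! ### Mollified restriction of negative powers -/

section SmearedLimit

open FourierTransform

variable {E : Type*} [NormedAddCommGroup E] [InnerProductSpace ℝ E] [FiniteDimensional ℝ E]
  [MeasurableSpace E] [BorelSpace E] {ρ : E → ℂ}
  {H : Type*} [NormedAddCommGroup H] [InnerProductSpace ℂ H] [CompleteSpace H]
  {A : H →ₗ.[ℂ] H} {ℓ : ℝ}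

theorem inner_smear_negPow_tensorSum (hA : IsSelfAdjoint A) (hℓ : 0 < ℓ) (hb : BoundedBelow A ℓ)
    {s : ℝ} (hs : 0 ≤ s) (hρ : IsMollifier ρ) {δ : ℝ} (hδ : 0 < δ) (F G : H) :
    ⟪smear ρ δ F, negPow (tensorSum A (negLaplacian E)) s (smear ρ δ G)⟫_ℂ
      = ∫ ξ : E, ((‖𝓕 ρ (δ • ξ)‖ ^ 2 : ℝ) : ℂ) * ⟪F, negPow (shiftOp A (lapSymbol ξ)) s G⟫_ℂ := by
  rw [← (fiberMap E H).inner_map_map, L2.inner_def]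
  refine integral_congr_ae ?_
  filter_upwards [coeFn_fiberMap_negPow_tensorSum hA hℓ hb hs (smear ρ δ G),
    coeFn_fiberMap_inclTensor_tmul F (rescaleL2 ρ δ),
    coeFn_fiberMap_inclTensor_tmul G (rescaleL2 ρ δ), coeFn_fourier_rescaleL2 hρ hδ]
    with ξ h1 h2 h3 h4
  rw [h1]
  simp only [smear]
  rw [h2, h3, h4, map_smul, inner_smul_left, inner_smul_right, ← mul_assoc, ← Complex.normSq_eq_conj_mul_self,
    Complex.normSq_eq_norm_sq]

theorem integrable_negPow_shiftOp_lapSymbol (hA : IsSelfAdjoint A) (hℓ : 0 < ℓ)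
    (hb : BoundedBelow A ℓ) {s : ℝ} (hs : (Module.finrank ℝ E : ℝ) < 2 * s) :
    Integrable (fun ξ : E => negPow (shiftOp A (lapSymbol ξ)) s) :=
  (integrable_negPow_shiftOp hA hℓ hb hs).comp_smul (by positivity : (2 * Real.pi) ≠ 0)

-- The substitution `q = 2πξ` turns `dξ` into `dq / (2π)^d`.
variable (E) in
theorem integral_negPow_shiftOp_lapSymbol (hA : IsSelfAdjoint A) (hℓ : 0 < ℓ)
    (hb : BoundedBelow A ℓ) {s : ℝ} (hs : (Module.finrank ℝ E : ℝ) < 2 * s) :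
    ∫ ξ : E, negPow (shiftOp A (lapSymbol ξ)) s
      = (((2 * Real.pi) ^ Module.finrank ℝ E)⁻¹ * ∫ q : E, (1 + ‖q‖ ^ 2) ^ (-s) : ℝ) •
        negPow A (s - Module.finrank ℝ E / 2) := by
  unfold lapSymbol
  rw [Measure.integral_comp_smul volume (fun q : E => negPow (shiftOp A (‖q‖ ^ 2)) s),
    integral_negPow_shiftOp E hA hℓ hb hs, abs_of_nonneg (by positivity), mul_smul]
  rfl

/-- The mollified restriction of a negative power of `A ⊗ I + I ⊗ (-Δ)`. -/
theorem tendsto_inner_smear_negPow_tensorSum (hA : IsSelfAdjoint A) (hℓ : 0 < ℓ)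
    (hb : BoundedBelow A ℓ) {s : ℝ} (hs : (Module.finrank ℝ E : ℝ) < 2 * s) (hρ : IsMollifier ρ)
    (F G : H) :
    Tendsto (fun δ : ℝ =>
      ⟪smear ρ δ F, negPow (tensorSum A (negLaplacian E)) s (smear ρ δ G)⟫_ℂ) (𝓝[>] 0)
      (𝓝 ((((2 * Real.pi) ^ Module.finrank ℝ E)⁻¹ * ∫ q : E, (1 + ‖q‖ ^ 2) ^ (-s) : ℝ) *
        ⟪F, negPow A (s - Module.finrank ℝ E / 2) G⟫_ℂ)) := by
  have hs0 : 0 ≤ s := by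
    have : (0 : ℝ) ≤ Module.finrank ℝ E := Nat.cast_nonneg _
    linarith
  have hint := integrable_negPow_shiftOp_lapSymbol (E := E) hA hℓ hb hs
  obtain ⟨C, hC⟩ := hρ.norm_fourier_le
  have hlim : ((((2 * Real.pi) ^ Module.finrank ℝ E)⁻¹ * ∫ q : E, (1 + ‖q‖ ^ 2) ^ (-s) : ℝ) : ℂ) *
      ⟪F, negPow A (s - Module.finrank ℝ E / 2) G⟫_ℂ
      = ∫ ξ : E, ⟪F, negPow (shiftOp A (lapSymbol ξ)) s G⟫_ℂ := by
    rw [integral_inner (hint.apply_continuousLinearMap G), ← ContinuousLinearMap.integral_apply hint,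
      integral_negPow_shiftOp_lapSymbol E hA hℓ hb hs, smul_apply, ← Complex.coe_smul,
      inner_smul_right]
  rw [hlim]
  refine Tendsto.congr' (f₁ := fun δ : ℝ => ∫ ξ : E, ((‖𝓕 ρ (δ • ξ)‖ ^ 2 : ℝ) : ℂ) *
    ⟪F, negPow (shiftOp A (lapSymbol ξ)) s G⟫_ℂ) ?_ ?_
  · filter_upwards [self_mem_nhdsWithin] with δ hδ
    exact (inner_smear_negPow_tensorSum hA hℓ hb hs0 hρ hδ F G).symm
  · have hg : Integrable (fun ξ : E => ⟪F, negPow (shiftOp A (lapSymbol ξ)) s G⟫_ℂ) :=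
      (hint.apply_continuousLinearMap G).const_inner F
    -- The factor `|ρ̂(δξ)|²` is bounded by `C²` uniformly in `δ`, and the remaining matrix element
    -- is integrable since `d < 2 s`.
    refine tendsto_integral_filter_of_dominated_convergence
      (fun ξ => C ^ 2 * ‖⟪F, negPow (shiftOp A (lapSymbol ξ)) s G⟫_ℂ‖)
      (.of_forall fun δ => ?_) (.of_forall fun δ => .of_forall fun ξ => ?_)
      (hg.norm.const_mul _) (.of_forall fun ξ => ?_)
    · refine AEStronglyMeasurable.mul (Continuous.aestronglyMeasurable ?_) hg.1
      have := hρ.continuous_fourier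
      fun_prop
    · rw [norm_mul, Complex.norm_real, norm_pow, norm_norm]
      gcongr
      exact hC _
    · have h1 : Continuous fun δ : ℝ => ((‖𝓕 ρ (δ • ξ)‖ ^ 2 : ℝ) : ℂ) *
          ⟪F, negPow (shiftOp A (lapSymbol ξ)) s G⟫_ℂ := by
        have := hρ.continuous_fourier
        fun_prop
      have h2 := (h1.tendsto 0).mono_left (nhdsWithin_le_nhds (s := Set.Ioi 0))
      simpa [hρ.fourier_zero] using h2

end SmearedLimit

/-! ### The cases of dimension one and three -/

section IntegerOrder

variable {H : Type*} [NormedAddCommGroup H] [InnerProductSpace ℂ H] [CompleteSpace H]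
  {A : H →ₗ.[ℂ] H} {ℓ : ℝ}

theorem tendsto_inner_smear_auxLift (hA : IsSelfAdjoint A) (hℓ : 0 < ℓ) (hb : BoundedBelow A ℓ)
    {ρ : ℝ → ℂ} (hρ : IsMollifier ρ) (F G : H) :
    Tendsto (fun δ : ℝ => ⟪smear ρ δ F, (invOp (auxLift A) ^ 3) (smear ρ δ G)⟫_ℂ) (𝓝[>] 0)
      (𝓝 ((3 / 16 : ℂ) * ⟪F, negPow A (5 / 2) G⟫_ℂ)) := by
  have h := tendsto_inner_smear_negPow_tensorSum (s := 3) hA hℓ hb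
    (by norm_num [Module.finrank_self]) hρ F G
  have h1 : invOp (auxLift A) ^ 3 = negPow (tensorSum A (negLaplacian ℝ)) 3 :=
    invOp_pow_three (isSelfAdjoint_tensorSum ℝ hA hℓ hb) hℓ (boundedBelow_tensorSum hA hℓ hb)
  rw [integral_inv_one_add_sq_pow_three, Module.finrank_self,
    show (3 : ℝ) - (1 : ℕ) / 2 = 5 / 2 by norm_num,
    show ((2 * Real.pi) ^ 1)⁻¹ * (3 * Real.pi / 8) = 3 / 16 by field_simp; norm_num] at h
  rw [h1]
  push_cast at h
  exact h

theorem integrable_invOp_shiftOp_pow_three (hA : IsSelfAdjoint A) (hℓ : 0 < ℓ)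
    (hb : BoundedBelow A ℓ) : Integrable (fun p : ℝ => invOp (shiftOp A (p ^ 2)) ^ 3) := by
  have h := integrable_negPow_shiftOp (E := ℝ) (s := 3) hA hℓ hb
    (by norm_num [Module.finrank_self])
  simpa only [Real.norm_eq_abs, sq_abs, ← invOp_shiftOp_pow_three hA hℓ hb (sq_nonneg _)] using h

theorem integral_invOp_shiftOp_pow_three (hA : IsSelfAdjoint A) (hℓ : 0 < ℓ)
    (hb : BoundedBelow A ℓ) :
    (2 * (Real.pi : ℂ))⁻¹ • ∫ p : ℝ, invOp (shiftOp A (p ^ 2)) ^ 3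
      = (3 / 16 : ℂ) • negPow A (5 / 2) := by
  have h := integral_negPow_shiftOp ℝ (s := 3) hA hℓ hb (by norm_num [Module.finrank_self])
  rw [integral_inv_one_add_sq_pow_three, Module.finrank_self,
    show (3 : ℝ) - (1 : ℕ) / 2 = 5 / 2 by norm_num] at h
  simp only [Real.norm_eq_abs, sq_abs] at h
  simp_rw [fun p : ℝ => invOp_shiftOp_pow_three hA hℓ hb (sq_nonneg p)]
  rw [h, smul_smul]
  congr 1
  have : (Real.pi : ℂ) ≠ 0 := Complex.ofReal_ne_zero.mpr Real.pi_ne_zero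
  push_cast
  field_simp
  norm_num

theorem tendsto_inner_smear_ambient (hA : IsSelfAdjoint A) (hℓ : 0 < ℓ) (hb : BoundedBelow A ℓ)
    {η : R3 → ℂ} (hη : IsMollifier η) (J K : H) :
    Tendsto (fun ε : ℝ => ⟪smear η ε J, negPow (ambient A) (5 / 2) (smear η ε K)⟫_ℂ) (𝓝[>] 0)
      (𝓝 ((1 / (6 * (Real.pi : ℂ) ^ 2)) * ⟪J, invOp A K⟫_ℂ)) := by
  have h := tendsto_inner_smear_negPow_tensorSum (s := 5 / 2) hA hℓ hb
    (by norm_num [finrank_euclideanSpace_fin]) hη J K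
  rw [integral_one_add_norm_sq_rpow_R3, finrank_euclideanSpace_fin,
    show (5 / 2 : ℝ) - (3 : ℕ) / 2 = 1 by norm_num, negPow_one hA hℓ hb,
    show ((2 * Real.pi) ^ 3)⁻¹ * (4 * Real.pi / 3) = 1 / (6 * Real.pi ^ 2) by field_simp; norm_num]
    at h
  exact_mod_cast h

theorem integral_negPow_shiftOp_R3 (hA : IsSelfAdjoint A) (hℓ : 0 < ℓ) (hb : BoundedBelow A ℓ) :
    ((2 * (Real.pi : ℂ)) ^ 3)⁻¹ • ∫ q : R3, negPow (shiftOp A (‖q‖ ^ 2)) (5 / 2)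
      = (1 / (6 * (Real.pi : ℂ) ^ 2)) • invOp A := by
  have h := integral_negPow_shiftOp R3 (s := 5 / 2) hA hℓ hb
    (by norm_num [finrank_euclideanSpace_fin])
  rw [integral_one_add_norm_sq_rpow_R3, finrank_euclideanSpace_fin,
    show (5 / 2 : ℝ) - (3 : ℕ) / 2 = 1 by norm_num, negPow_one hA hℓ hb] at h
  rw [h, smul_smul]
  congr 1
  have : (Real.pi : ℂ) ≠ 0 := Complex.ofReal_ne_zero.mpr Real.pi_ne_zero
  push_cast
  field_simp
  norm_num

theorem isSelfAdjoint_shiftOp (hA : IsSelfAdjoint A) (hℓ : 0 < ℓ) (hb : BoundedBelow A ℓ) {c : ℝ}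
    (hc : 0 ≤ c) : IsSelfAdjoint (shiftOp A c) :=
  isSelfAdjoint_of_surjective (by positivity : 0 < ℓ + c) (hb.shift c)
    (shiftOp_isFormalAdjoint (isFormalAdjoint_of_isSelfAdjoint hA) c) fun y =>
      let ⟨h1, h2⟩ := (isBoundedInverse_invOp_shiftOp hA hℓ hb hc).2 y
      ⟨⟨_, h1⟩, h2⟩

theorem integrable_invOp_shiftOp_pow_three_prod (hA : IsSelfAdjoint A) (hℓ : 0 < ℓ)
    (hb : BoundedBelow A ℓ) :
    Integrable (fun x : R3 × ℝ => invOp (shiftOp A (‖x.1‖ ^ 2 + x.2 ^ 2)) ^ 3) := by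
  simp_rw [fun x : R3 × ℝ => invOp_shiftOp_pow_three hA hℓ hb
    (by positivity : 0 ≤ ‖x.1‖ ^ 2 + x.2 ^ 2)]
  refine integrable_negPow_shiftOp_comp hA hℓ hb (by fun_prop) (fun x => by positivity)
    (by norm_num) ?_
  -- The exponent splits as `3 = 2 + 1`: `(ℓ + |q|² + p²)^{-3} ≤ (ℓ + |q|²)^{-2} (ℓ + p²)^{-1}`, and
  -- both factors are integrable because `3 < 2 · 2` and `1 < 2 · 1`.
  have h1 := integrable_add_norm_sq_rpow_neg (E := R3) (m := ℓ) (s := 2) hℓ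
    (by norm_num [finrank_euclideanSpace_fin])
  have h2 := integrable_add_norm_sq_rpow_neg (E := ℝ) (m := ℓ) (s := 1) hℓ
    (by norm_num [Module.finrank_self])
  refine (h1.mul_prod h2).mono' (Measurable.aestronglyMeasurable (by fun_prop))
    (.of_forall fun x => ?_)
  rw [Real.norm_of_nonneg (by positivity), Real.norm_eq_abs, sq_abs,
    show (-3 : ℝ) = -2 + -1 by norm_num, Real.rpow_add (by positivity)]
  gcongr ?_ * ?_
  · exact Real.rpow_le_rpow_of_nonpos (by positivity) (by nlinarith [sq_nonneg x.2]) (by norm_num)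
  · exact Real.rpow_le_rpow_of_nonpos (by positivity) (by nlinarith [sq_nonneg ‖x.1‖]) (by norm_num)

/-- The inner integral is the one-dimensional identity for the self-adjoint operator `A + |q|² ≥ ℓ +
|q|²`; the outer one is the three-dimensional identity for `A`. -/
theorem iterated_integral_invOp_shiftOp_pow_three (hA : IsSelfAdjoint A) (hℓ : 0 < ℓ)
    (hb : BoundedBelow A ℓ) :
    ((2 * (Real.pi : ℂ)) ^ 3)⁻¹ • ∫ q : R3,
        (2 * (Real.pi : ℂ))⁻¹ • ∫ p : ℝ, invOp (shiftOp A (‖q‖ ^ 2 + p ^ 2)) ^ 3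
      = (1 / (32 * (Real.pi : ℂ) ^ 2)) • invOp A := by
  have h1 : ∀ q : R3, (2 * (Real.pi : ℂ))⁻¹ • ∫ p : ℝ, invOp (shiftOp A (‖q‖ ^ 2 + p ^ 2)) ^ 3
      = (3 / 16 : ℂ) • negPow (shiftOp A (‖q‖ ^ 2)) (5 / 2) := by
    intro q
    rw [← integral_invOp_shiftOp_pow_three (isSelfAdjoint_shiftOp hA hℓ hb (sq_nonneg ‖q‖))
      (by positivity : 0 < ℓ + ‖q‖ ^ 2) (hb.shift _)]
    simp_rw [shiftOp_shiftOp]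
  simp_rw [h1]
  rw [integral_smul, smul_comm, integral_negPow_shiftOp_R3 hA hℓ hb, smul_smul]
  congr 1
  ring

end IntegerOrder

end IntegerLift

theorem mainTheorem8
    {H HB : Type*}
    [NormedAddCommGroup H] [InnerProductSpace ℂ H] [CompleteSpace H]
    [NormedAddCommGroup HB] [InnerProductSpace ℂ HB] [CompleteSpace HB]
    (A : H →ₗ.[ℂ] H) (hA : IsSelfAdjoint A) (ℓ : ℝ) (hℓ : 0 < ℓ) (hAℓ : BoundedBelow A ℓ)
    (LB : HB →ₗ.[ℂ] HB) (hLB : IsSelfAdjoint LB) (ℓB : ℝ) (hℓB : 0 < ℓB)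
    (hLBℓ : BoundedBelow LB ℓB) :
    -- The auxiliary lift of `A`.
    ((IsSelfAdjoint (auxLift A) ∧ BoundedBelow (auxLift A) ℓ) ∧
      (∀ ρ : ℝ → ℂ, IsMollifier ρ → ∀ F G : H,
        Tendsto (fun δ : ℝ => ⟪smear ρ δ F, (invOp (auxLift A) ^ 3) (smear ρ δ G)⟫_ℂ) (𝓝[>] 0)
          (𝓝 ((3 / 16 : ℂ) * ⟪F, negPow A (5 / 2) G⟫_ℂ))) ∧
      Integrable (fun p : ℝ => invOp (shiftOp A (p ^ 2)) ^ 3) ∧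
      (2 * (Real.pi : ℂ))⁻¹ • ∫ p : ℝ, invOp (shiftOp A (p ^ 2)) ^ 3
        = (3 / 16 : ℂ) • negPow A (5 / 2)) ∧
    -- The combination with the codimension-three reduction.
    ((IsSelfAdjoint (ambient LB) ∧ BoundedBelow (ambient LB) ℓB ∧ IsSelfAdjoint (auxLift (ambient LB)) ∧ BoundedBelow (auxLift (ambient LB)) ℓB) ∧
      -- The combined reduction through mollified restrictions: first in `ℝ`, then in `ℝ³`.
      (∀ ρ : ℝ → ℂ, IsMollifier ρ → ∀ η : R3 → ℂ, IsMollifier η →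
        ∀ J K : HB,
          (∀ ε : ℝ, 0 < ε →
            Tendsto
              (fun δ : ℝ =>
                ⟪smear ρ δ (smear η ε J), (invOp (auxLift (ambient LB)) ^ 3) (smear ρ δ (smear η ε K))⟫_ℂ)
              (𝓝[>] 0)
              (𝓝 ((3 / 16 : ℂ) * ⟪smear η ε J, negPow (ambient LB) (5 / 2) (smear η ε K)⟫_ℂ))) ∧
          Tendsto (fun ε : ℝ => ⟪smear η ε J, negPow (ambient LB) (5 / 2) (smear η ε K)⟫_ℂ) (𝓝[>] 0)
            (𝓝 ((1 / (6 * (Real.pi : ℂ) ^ 2)) * ⟪J, invOp LB K⟫_ℂ)) ∧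
          Tendsto
            (fun ε : ℝ => (3 / 16 : ℂ) * ⟪smear η ε J, negPow (ambient LB) (5 / 2) (smear η ε K)⟫_ℂ)
            (𝓝[>] 0)
            (𝓝 ((1 / (32 * (Real.pi : ℂ) ^ 2)) * ⟪J, invOp LB K⟫_ℂ))) ∧
      -- The two steps as operator-norm Bochner integrals.
      (Integrable (fun p : ℝ => invOp (shiftOp (ambient LB) (p ^ 2)) ^ 3) ∧
        (16 / 3 : ℂ) • (2 * (Real.pi : ℂ))⁻¹ • ∫ p : ℝ, invOp (shiftOp (ambient LB) (p ^ 2)) ^ 3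
          = negPow (ambient LB) (5 / 2)) ∧
      (Integrable
          (fun q : R3 => negPow (shiftOp LB (‖q‖ ^ 2)) (5 / 2)) ∧
        ((2 * (Real.pi : ℂ)) ^ 3)⁻¹ •
            ∫ q : R3, negPow (shiftOp LB (‖q‖ ^ 2)) (5 / 2)
          = (1 / (6 * (Real.pi : ℂ) ^ 2)) • invOp LB) ∧
      -- The combined four-dimensional operator-norm Bochner integral.
      (Integrable
          (fun x : R3 × ℝ => invOp (shiftOp LB (‖x.1‖ ^ 2 + x.2 ^ 2)) ^ 3) ∧
        ((2 * (Real.pi : ℂ)) ^ 3)⁻¹ • ∫ q : R3,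
            (2 * (Real.pi : ℂ))⁻¹ • ∫ p : ℝ, invOp (shiftOp LB (‖q‖ ^ 2 + p ^ 2)) ^ 3
          = (1 / (32 * (Real.pi : ℂ) ^ 2)) • invOp LB)) := by
  -- `L_M` inherits self-adjointness and the bound `ℓB`, so every one-dimensional statement applies
  -- to it in place of `A`.
  have hM := isSelfAdjoint_tensorSum R3 hLB hℓB hLBℓ
  have hMℓ := boundedBelow_tensorSum (E := R3) hLB hℓB hLBℓ
  refine ⟨⟨⟨isSelfAdjoint_tensorSum ℝ hA hℓ hAℓ, boundedBelow_tensorSum hA hℓ hAℓ⟩,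
    fun ρ hρ F G => tendsto_inner_smear_auxLift hA hℓ hAℓ hρ F G,
    integrable_invOp_shiftOp_pow_three hA hℓ hAℓ, integral_invOp_shiftOp_pow_three hA hℓ hAℓ⟩,
    ⟨hM, hMℓ, isSelfAdjoint_tensorSum ℝ hM hℓB hMℓ, boundedBelow_tensorSum hM hℓB hMℓ⟩,
    fun ρ hρ η hη J K => ⟨fun ε _ => tendsto_inner_smear_auxLift hM hℓB hMℓ hρ _ _,
      tendsto_inner_smear_ambient hLB hℓB hLBℓ hη J K, ?_⟩,
    ⟨integrable_invOp_shiftOp_pow_three hM hℓB hMℓ, ?_⟩,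
    ⟨integrable_negPow_shiftOp hLB hℓB hLBℓ (by norm_num [finrank_euclideanSpace_fin]),
      integral_negPow_shiftOp_R3 hLB hℓB hLBℓ⟩,
    integrable_invOp_shiftOp_pow_three_prod hLB hℓB hLBℓ,
    iterated_integral_invOp_shiftOp_pow_three hLB hℓB hLBℓ⟩
  -- `3/16 · 1/(6π²) = 1/(32π²)`.
  · convert (tendsto_inner_smear_ambient hLB hℓB hLBℓ hη J K).const_mul (3 / 16 : ℂ) using 2
    ring
  · have h := integral_invOp_shiftOp_pow_three hM hℓB hMℓ
    refine (congrArg ((16 / 3 : ℂ) • ·) h).trans ?_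
    simp only [smul_smul]
    norm_num
    rfl
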